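/- Let $(M,g)$ be a compact smooth Riemannian manifold without boundary, with Levi-Civita connection $\nabla$ and Riemannian volume $\mu$; functions and vector fields are smooth unless said otherwise, and $\|X\|^2:=g(X,X)$. A vector field $X$ is Killing if $g(\nabla_VX,W)=-g(\nabla_WX,V)$ for all vector fields $V,W$. A vector field $Z$ is a zonal flow if (1) $Z=fX$ for some function $f$ and some Killing vector field $X$, (2) $\operatorname{div}Z=0$, and (3) $\nabla_ZZ=-\operatorname{grad}P$ for some function $P$ on $M$. For vector fields $Z,Y$ put $$\mathfrak{mc}_{Z,Y}:=-\int_M g([Z,Y],[Z,Y])\,\mu-\int_M g(Z,[[Z,Y],Y])\,\mu .$$ Let $Z=fX$ be a zonal flow on $M$, with a function $f$ and a Killing vector field $X$, and let $U_0:=\{x\in M\mid \operatorname{grad}(\|X\|^2)\neq 0\}$. There is a function $F$ on $U_0$ with $$\operatorname{grad}(f^2)=F\operatorname{grad}(\|X\|^2)\quad\text{on }U_0 ,$$ and for every such function $F$ and every divergence-free vector field $Y$ on $M$ with $[X,Y]=0$ the following hold. 1. The function $F\,Y(\|X\|^2)^2$ is integrable on $U_0$, and $$\mathfrak{mc}_{Z,Y}=\frac12\int_{U_0}F\,Y(\|X\|^2)^2\,\mu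 .$$ 2. Let $U^+:=\{x\in U_0\mid F(x)>0\}$. If $\operatorname{supp}Y\subset U^+$ and $Y(\|X\|^2)$ does not vanish identically on $U^+$, then $\mathfrak{mc}_{Z,Y}>0$. -/

import Mathlib

open scoped Manifold ContDiff
open MeasureTheory

noncomputable section

namespace ZonalFlow

variable {n : ℕ} {M : Type*} [TopologicalSpace M] [ChartedSpace (EuclideanSpace ℝ (Fin n)) M]

/-- (Not necessarily smooth) vector fields on the `n`-manifold `M`. -/
abbrev VField (n : ℕ) (M : Type*) [TopologicalSpace M]
    [ChartedSpace (EuclideanSpace ℝ (Fin n)) M] : Type _ :=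
  (p : M) → TangentSpace (𝓡 n) p

/-- Smooth Riemannian metrics on the smooth `n`-manifold `M`. -/
abbrev SmoothMetric (n : ℕ) (M : Type*) [TopologicalSpace M]
    [ChartedSpace (EuclideanSpace ℝ (Fin n)) M] [IsManifold (𝓡 n) ∞ M] : Type _ :=
  Bundle.ContMDiffRiemannianMetric (𝓡 n) ∞ (EuclideanSpace ℝ (Fin n))
    (fun p : M => TangentSpace (𝓡 n) p)

/-- The vector field `V` is smooth, as a section of the tangent bundle. -/
def IsSmoothField [IsManifold (𝓡 n) ∞ M] (V : VField n M) : Prop :=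
  ContMDiff (𝓡 n) (𝓡 n).tangent ∞ (fun p => (⟨p, V p⟩ : TangentBundle (𝓡 n) M))

/-- The function `h : M → ℝ` is smooth. -/
def IsSmoothFun (n : ℕ) {M : Type*} [TopologicalSpace M]
    [ChartedSpace (EuclideanSpace ℝ (Fin n)) M] (h : M → ℝ) : Prop :=
  ContMDiff (𝓡 n) 𝓘(ℝ, ℝ) ∞ h

/-- The differential `dh` of the function `h` at the point `p`. -/
def differential (h : M → ℝ) (p : M) : TangentSpace (𝓡 n) p →L[ℝ] ℝ :=
  mfderiv (𝓡 n) 𝓘(ℝ, ℝ) h p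

/-- The derivative `V(h) = dh(V)` of the function `h` along the vector field `V`. -/
def lieDeriv (V : VField n M) (h : M → ℝ) (p : M) : ℝ :=
  differential h p (V p)

/-- The partial derivative `∂φ/∂yⁱ` of a function on `ℝⁿ`. -/
def partialDeriv (i : Fin n) (φ : EuclideanSpace ℝ (Fin n) → ℝ)
    (y : EuclideanSpace ℝ (Fin n)) : ℝ :=
  fderiv ℝ φ y (EuclideanSpace.single i 1)

/-- The differential at `q` of the chart around `c`; it is only used at points `q` of the domain of
this chart, where it is invertible. -/
def chartDeriv (c q : M) : TangentSpace (𝓡 n) q →L[ℝ] EuclideanSpace ℝ (Fin n) :=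
  mfderiv (𝓡 n) (𝓡 n) (chartAt (EuclideanSpace ℝ (Fin n)) c) q

/-- The coordinate vector `∂/∂yⁱ` at `q` of the chart around `c`. -/
def coordVector (c : M) (i : Fin n) (q : M) : TangentSpace (𝓡 n) q :=
  (chartDeriv c q).inverse (EuclideanSpace.single i (1 : ℝ))

/-- The `i`-th component `Vⁱ` of the vector field `V` in the chart around `c`, as a function of
the coordinates. -/
def component (c : M) (V : VField n M) (i : Fin n) (y : EuclideanSpace ℝ (Fin n)) : ℝ :=
  (chartDeriv c ((chartAt (EuclideanSpace ℝ (Fin n)) c).symm y)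
    (V ((chartAt (EuclideanSpace ℝ (Fin n)) c).symm y))) i

/-- The support of the vector field `V`. -/
def fieldSupport (V : VField n M) : Set M :=
  closure {p | V p ≠ 0}

variable [IsManifold (𝓡 n) ∞ M]

/-- The function `‖X‖² = g(X, X)`. -/
def normSq (g : SmoothMetric n M) (X : VField n M) (p : M) : ℝ :=
  g.inner p (X p) (X p)

/-- The scalar product `g_p` as a bilinear form on the tangent space at `p`. -/
def metricForm (g : SmoothMetric n M) (p : M) :
    LinearMap.BilinForm ℝ (TangentSpace (𝓡 n) p) :=
  LinearMap.mk₂ ℝ (fun v w => g.inner p v w) (by simp) (by simp) (by simp) (by simp)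

theorem metricForm_nondegenerate (g : SmoothMetric n M) (p : M) :
    (metricForm g p).Nondegenerate := by
  refine ⟨fun v hv => ?_, fun v hv => ?_⟩ <;>
  · by_contra h
    exact absurd (hv v) (g.pos p v h).ne'

instance (p : M) : FiniteDimensional ℝ (TangentSpace (𝓡 n) p) :=
  inferInstanceAs (FiniteDimensional ℝ (EuclideanSpace ℝ (Fin n)))

/-- The gradient of `h`: the vector field with `g(grad h, v) = dh(v)` for all tangent vectors
`v`. -/
def gradient (g : SmoothMetric n M) (h : M → ℝ) : VField n M := fun p =>
  ((metricForm g p).toDual (metricForm_nondegenerate g p)).symm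
    (differential (n := n) h p).toLinearMap

theorem inner_gradient (g : SmoothMetric n M) (h : M → ℝ) (p : M) (v : TangentSpace (𝓡 n) p) :
    g.inner p (gradient g h p) v = differential h p v :=
  LinearMap.BilinForm.apply_toDual_symm_apply (hB := metricForm_nondegenerate g p) _ v

/-- The matrix `(g_{ij})` of the metric in the chart around `c`, as a function of the
coordinates. -/
def metricMatrix (g : SmoothMetric n M) (c : M) (y : EuclideanSpace ℝ (Fin n)) :
    Matrix (Fin n) (Fin n) ℝ :=
  Matrix.of fun i j => g.inner ((chartAt (EuclideanSpace ℝ (Fin n)) c).symm y)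
    (coordVector c i _) (coordVector c j _)

/-- The density `√(det (g_{ij}))` of the Riemannian volume in the chart around `c`. -/
def volumeDensity (g : SmoothMetric n M) (c : M) (y : EuclideanSpace ℝ (Fin n)) : ℝ :=
  √(metricMatrix g c y).det

/-- The Christoffel symbol
`Γᵏ_{ij} = ½ ∑ₗ gᵏˡ (∂ᵢ g_{jl} + ∂ⱼ g_{il} - ∂ₗ g_{ij})` in the chart around `c`. -/
def christoffel (g : SmoothMetric n M) (c : M) (k i j : Fin n)
    (y : EuclideanSpace ℝ (Fin n)) : ℝ :=
  (1 / 2) * ∑ l, (metricMatrix g c y)⁻¹ k l *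
    (partialDeriv i (fun z => metricMatrix g c z j l) y
      + partialDeriv j (fun z => metricMatrix g c z i l) y
      - partialDeriv l (fun z => metricMatrix g c z i j) y)

/-- The component `(∇_V W)ᵏ = ∑ᵢ Vⁱ ∂ᵢWᵏ + ∑ᵢⱼ Γᵏ_{ij} Vⁱ Wʲ` of the covariant derivative in the
chart around `c`. -/
def covComponent (g : SmoothMetric n M) (c : M) (V W : VField n M) (k : Fin n)
    (y : EuclideanSpace ℝ (Fin n)) : ℝ :=
  (∑ i, component c V i y * partialDeriv i (component c W k) y)
    + ∑ i, ∑ j, christoffel g c k i j y * component c V i y * component c W j y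

/-- The covariant derivative `∇_V W` for the Levi-Civita connection of `g`, computed at each point
`p` in the preferred chart around `p`. -/
def covDeriv (g : SmoothMetric n M) (V W : VField n M) : VField n M := fun p =>
  ∑ k, covComponent g p V W k (chartAt (EuclideanSpace ℝ (Fin n)) p p) • coordVector p k p

/-- The divergence `(1/√det g) ∑ᵢ ∂ᵢ(√det g Vⁱ)` of `V` in the chart around `c`, that is, the
function `div V` with `L_V μ = (div V) μ`, as a function of the coordinates. -/
def chartDivergence (g : SmoothMetric n M) (c : M) (V : VField n M)
    (y : EuclideanSpace ℝ (Fin n)) : ℝ :=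
  (volumeDensity g c y)⁻¹ *
    ∑ i, partialDeriv i (fun z => volumeDensity g c z * component c V i z) y

/-- `div V = 0`: the divergence vanishes at all points, in all charts. -/
def IsDivergenceFree (g : SmoothMetric n M) (V : VField n M) : Prop :=
  ∀ c : M, ∀ y ∈ (chartAt (EuclideanSpace ℝ (Fin n)) c).target, chartDivergence g c V y = 0

/-- `X` is a Killing vector field: `g(∇_V X, W) = -g(∇_W X, V)` for all vector fields `V`, `W`. -/
def IsKilling (g : SmoothMetric n M) (X : VField n M) : Prop :=
  IsSmoothField X ∧ ∀ V W : VField n M, IsSmoothField V → IsSmoothField W → ∀ p,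
    g.inner p (covDeriv g V X p) (W p) = -g.inner p (covDeriv g W X p) (V p)

/-- `Z` is a zonal flow: `Z = fX` with a function `f` and a Killing vector field `X`, `div Z = 0`,
and the projection of `∇_Z Z` to the divergence-free fields along the gradient fields vanishes,
that is, `∇_Z Z = -grad P` for some function `P`. -/
def IsZonalFlow (g : SmoothMetric n M) (Z : VField n M) : Prop :=
  (∃ (f : M → ℝ) (X : VField n M), IsSmoothFun n f ∧ IsKilling g X ∧ ∀ p, Z p = f p • X p) ∧
  IsDivergenceFree g Z ∧
  ∃ P : M → ℝ, IsSmoothFun n P ∧ ∀ p, covDeriv g Z Z p = -gradient g P p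

/-- The Riemannian volume measure `μ` of `g`. For each chart, `√(det (g_{ij})) dy` defines a measure
on its domain, which is extended by zero to `M`. These measures agree on the intersections of the
domains, and `μ` is the smallest measure that is at least each of them, that is, the measure
obtained by gluing. -/
def volumeMeasure [MeasurableSpace M] (g : SmoothMetric n M) : Measure M :=
  ⨆ c : M, ((volume.restrict (chartAt (EuclideanSpace ℝ (Fin n)) c).target).withDensity
    (fun y => ENNReal.ofReal (volumeDensity g c y))).map
      (chartAt (EuclideanSpace ℝ (Fin n)) c).symm

/-- The Misiołek curvature
`mc_{Z,Y} = -∫ g([Z,Y], [Z,Y]) μ - ∫ g(Z, [[Z,Y],Y]) μ`. -/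
def misiolekCurvature [MeasurableSpace M] (g : SmoothMetric n M) (Z Y : VField n M) : ℝ :=
  -(∫ p, g.inner p (VectorField.mlieBracket (𝓡 n) Z Y p) (VectorField.mlieBracket (𝓡 n) Z Y p)
      ∂(volumeMeasure g))
  - ∫ p, g.inner p (Z p)
      (VectorField.mlieBracket (𝓡 n) (VectorField.mlieBracket (𝓡 n) Z Y) Y p) ∂(volumeMeasure g)

/-- The set `U₀` where `grad ‖X‖² ≠ 0`. -/
def regularSet (g : SmoothMetric n M) (X : VField n M) : Set M :=
  {p | gradient g (normSq g X) p ≠ 0}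

/-- `F` satisfies `grad(f²) = F grad(‖X‖²)` on `U₀`; its values outside `U₀` are irrelevant. -/
def IsGradRatio (g : SmoothMetric n M) (f : M → ℝ) (X : VField n M) (F : M → ℝ) : Prop :=
  ∀ p ∈ regularSet g X,
    gradient g (fun q => f q ^ 2) p = F p • gradient g (normSq g X) p

end ZonalFlow

end

noncomputable section

namespace ZonalFlow

variable {n : ℕ} {M : Type*} [TopologicalSpace M] [ChartedSpace (EuclideanSpace ℝ (Fin n)) M]
  [IsManifold (𝓡 n) ∞ M]

local notation "𝔼" => EuclideanSpace ℝ (Fin n)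

/-! Write η = ‖X‖². A Killing field has divergence zero, so div(fX) = X(f), and condition (2) gives
X(f) = 0. Therefore ∇_Z Z = f² ∇_X X + f X(f) X = f² ∇_X X, and Killing's equation gives ∇_X X = -½
grad η. Condition (3) then reads f² dη = 2 dP. Since the right side is closed, d(f²) ∧ dη = 0, so
d(f²) is a multiple of dη wherever dη ≠ 0. This is the factor F (`IsZonalFlow.exists_isGradRatio`).

If [X,Y] = 0, then [fX,Y] = -Y(f) X and [[fX,Y],Y] = Y(Y(f)) X, so the curvature is -∫ (Y(f)² + f
Y(Y(f))) η. As div Y = 0, the integral of Y(f Y(f) η) vanishes, which turns this into ∫ f Y(f) Y(η)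
= ½ ∫ Y(f²) Y(η) (`misiolekCurvature_smul_eq`). On U₀ the integrand is F Y(η)², and off U₀ it is
zero because dη = 0 there.

For the sign, this integrand is continuous; under the support hypothesis it is nonnegative on all of
M and nonzero at some point, and the volume charges open sets.

Connection, divergence and volume are defined by coordinate formulas, so the classical facts used
above (metric compatibility, the trace of L_X g = 0, gluing of the chart volumes, the divergence
theorem) are derived in charts. -/

/-! ### Vector fields, metric and differentials in a chart -/

theorem chartDeriv_isInvertible {c q : M} (hq : q ∈ (chartAt 𝔼 c).source) :
    (chartDeriv (n := n) c q).IsInvertible := by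
  have : IsManifold (𝓡 n) 1 M := .of_le (n := ∞) (by norm_num)
  exact isInvertible_mfderiv_extChartAt (I := 𝓡 n) (x := c) (by simpa using hq)

theorem continuousLinearMapAt_eq_chartDeriv {c q : M} (hq : q ∈ (chartAt 𝔼 c).source) :
    (trivializationAt 𝔼 (TangentSpace (𝓡 n)) c).continuousLinearMapAt ℝ q
      = chartDeriv (n := n) c q := by
  have : IsManifold (𝓡 n) 1 M := .of_le (n := ∞) (by norm_num)
  exact TangentBundle.continuousLinearMapAt_trivializationAt hq

theorem trivializationAt_snd_eq_chartDeriv {c q : M} (hq : q ∈ (chartAt 𝔼 c).source)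
    (v : TangentSpace (𝓡 n) q) :
    (trivializationAt 𝔼 (TangentSpace (𝓡 n)) c ⟨q, v⟩).2 = chartDeriv (n := n) c q v := by
  have hb : q ∈ (trivializationAt 𝔼 (TangentSpace (𝓡 n)) c).baseSet := by simpa using hq
  rw [← continuousLinearMapAt_eq_chartDeriv hq]
  simp only [Bundle.Trivialization.continuousLinearMapAt_apply]
  rw [Bundle.Trivialization.coe_linearMapAt_of_mem _ hb]

theorem chartDeriv_coordVector {c q : M} (hq : q ∈ (chartAt 𝔼 c).source) (i : Fin n) :
    chartDeriv c q (coordVector c i q) = EuclideanSpace.single i (1 : ℝ) :=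
  (chartDeriv_isInvertible hq).self_apply_inverse _

theorem eq_sum_coordVector {c q : M} (hq : q ∈ (chartAt 𝔼 c).source) (v : TangentSpace (𝓡 n) q) :
    v = ∑ i, (chartDeriv c q v) i • coordVector c i q := by
  apply (chartDeriv_isInvertible hq).injective
  simp only [map_sum, map_smul, chartDeriv_coordVector hq]
  ext j
  simp [Finset.sum_apply, Pi.single_apply]

/-- The chart differential is the tangent bundle trivialization over the chart domain, so smoothness
of a section can be tested on its components. -/
theorem contMDiffOn_iff_chartDeriv (c : M) (V : VField n M) {s : Set M}
    (hs : s ⊆ (chartAt 𝔼 c).source) (ho : IsOpen s) :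
    ContMDiffOn (𝓡 n) (𝓡 n).tangent ∞ (fun p => (⟨p, V p⟩ : TangentBundle (𝓡 n) M)) s ↔
      ContMDiffOn (𝓡 n) 𝓘(ℝ, 𝔼) ∞ (fun p => chartDeriv c p (V p)) s := by
  have h := (trivializationAt 𝔼 (TangentSpace (𝓡 n)) c).contMDiffOn_section_iff (n := ∞)
    (IB := 𝓡 n) (s := V) (a := s) ho (by simpa using hs)
  refine h.trans (contMDiffOn_congr fun q hq => ?_)
  exact (trivializationAt_snd_eq_chartDeriv (hs hq) _)

theorem coordVector_contMDiffOn (c : M) (i : Fin n) :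
    ContMDiffOn (𝓡 n) (𝓡 n).tangent ∞
      (fun p => (⟨p, coordVector c i p⟩ : TangentBundle (𝓡 n) M)) (chartAt 𝔼 c).source := by
  rw [contMDiffOn_iff_chartDeriv c _ le_rfl (chartAt 𝔼 c).open_source]
  exact contMDiffOn_const.congr fun q hq => chartDeriv_coordVector hq i

theorem contDiffOn_comp_symm {F : Type*} [NormedAddCommGroup F] [NormedSpace ℝ F] {c : M}
    {h : M → F} (hh : ContMDiffOn (𝓡 n) 𝓘(ℝ, F) ∞ h (chartAt 𝔼 c).source) :
    ContDiffOn ℝ ∞ (h ∘ (chartAt 𝔼 c).symm) (chartAt 𝔼 c).target := by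
  rw [← contMDiffOn_iff_contDiffOn]
  exact hh.comp (contMDiffOn_chart_symm (I := 𝓡 n)) (chartAt 𝔼 c).symm.mapsTo

theorem IsSmoothFun.contDiffOn {h : M → ℝ} (hh : IsSmoothFun n h) (c : M) :
    ContDiffOn ℝ ∞ (h ∘ (chartAt 𝔼 c).symm) (chartAt 𝔼 c).target :=
  contDiffOn_comp_symm hh.contMDiffOn

theorem IsSmoothField.component_contDiffOn {V : VField n M} (hV : IsSmoothField V) (c : M)
    (i : Fin n) : ContDiffOn ℝ ∞ (component c V i) (chartAt 𝔼 c).target := by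
  have h := (contMDiffOn_iff_chartDeriv c V le_rfl (chartAt 𝔼 c).open_source).1 hV.contMDiffOn
  exact (EuclideanSpace.proj (𝕜 := ℝ) i).contDiff.comp_contDiffOn (contDiffOn_comp_symm h)

theorem metric_contMDiffOn (g : SmoothMetric n M) {V W : VField n M} {s : Set M}
    (hV : ContMDiffOn (𝓡 n) (𝓡 n).tangent ∞ (fun p => (⟨p, V p⟩ : TangentBundle (𝓡 n) M)) s)
    (hW : ContMDiffOn (𝓡 n) (𝓡 n).tangent ∞ (fun p => (⟨p, W p⟩ : TangentBundle (𝓡 n) M)) s) :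
    ContMDiffOn (𝓡 n) 𝓘(ℝ, ℝ) ∞ (fun p => g.inner p (V p) (W p)) s := by
  intro x hx
  have : ContMDiffWithinAt (𝓡 n) ((𝓡 n).prod 𝓘(ℝ)) ∞
      (fun m ↦ Bundle.TotalSpace.mk' ℝ (E := Bundle.Trivial M ℝ) m (g.inner m (V m) (W m))) s x := by
    apply ContMDiffWithinAt.clm_bundle_apply₂ (F₁ := 𝔼) (F₂ := 𝔼)
    · exact g.contMDiff.contMDiffAt.contMDiffWithinAt
    · exact hV x hx
    · exact hW x hx
  simp only [Bundle.contMDiffWithinAt_totalSpace] at this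
  exact this.2

theorem metricMatrix_contDiffOn (g : SmoothMetric n M) (c : M) (i j : Fin n) :
    ContDiffOn ℝ ∞ (fun y => metricMatrix g c y i j) (chartAt 𝔼 c).target :=
  contDiffOn_comp_symm
    (metric_contMDiffOn g (coordVector_contMDiffOn c i) (coordVector_contMDiffOn c j))

theorem metric_eq_sum (g : SmoothMetric n M) (V W : VField n M) {c : M} {y : 𝔼}
    (hy : y ∈ (chartAt 𝔼 c).target) :
    g.inner ((chartAt 𝔼 c).symm y) (V ((chartAt 𝔼 c).symm y)) (W ((chartAt 𝔼 c).symm y))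
      = ∑ i, ∑ j, metricMatrix g c y i j * component c V i y * component c W j y := by
  have hq := (chartAt 𝔼 c).map_target hy
  conv_lhs => rw [eq_sum_coordVector hq (V _), eq_sum_coordVector hq (W _)]
  simp only [map_sum, map_smul, sum_apply, smul_apply,
    smul_eq_mul, metricMatrix, Matrix.of_apply, component, Finset.mul_sum]
  rw [Finset.sum_comm]
  refine Finset.sum_congr rfl fun i _ => Finset.sum_congr rfl fun j _ => ?_
  ring

/-- The derivative in a chart. -/
theorem mfderiv_eq_fderiv_chart {F : Type*} [NormedAddCommGroup F] [NormedSpace ℝ F] {h : M → F}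
    {c q : M} (hq : q ∈ (chartAt 𝔼 c).source) (hh : MDifferentiableAt (𝓡 n) 𝓘(ℝ, F) h q) :
    DifferentiableAt ℝ (h ∘ (chartAt 𝔼 c).symm) (chartAt 𝔼 c q) ∧
    ∀ v : TangentSpace (𝓡 n) q, mfderiv (𝓡 n) 𝓘(ℝ, F) h q v
      = fderiv ℝ (h ∘ (chartAt 𝔼 c).symm) (chartAt 𝔼 c q) (chartDeriv c q v) := by
  have : IsManifold (𝓡 n) 1 M := .of_le (n := ∞) (by norm_num)
  set e := chartAt 𝔼 c
  have he : MDifferentiableAt (𝓡 n) (𝓡 n) e q :=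
    mdifferentiableAt_atlas (chart_mem_atlas 𝔼 c) hq
  have hes : MDifferentiableAt (𝓡 n) (𝓡 n) e.symm (e q) :=
    mdifferentiableAt_atlas_symm (chart_mem_atlas 𝔼 c) (e.map_source hq)
  have hq' : e.symm (e q) = q := e.left_inv hq
  have hcomp : MDifferentiableAt (𝓡 n) 𝓘(ℝ, F) (h ∘ e.symm) (e q) :=
    MDifferentiableAt.comp (I' := 𝓡 n) _ (by rwa [hq']) hes
  have hev : h =ᶠ[nhds q] (h ∘ e.symm) ∘ e := by
    filter_upwards [e.open_source.mem_nhds hq] with x hx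
    simp [e.left_inv hx]
  have h1 : mfderiv (𝓡 n) 𝓘(ℝ, F) h q
      = (mfderiv (𝓡 n) 𝓘(ℝ, F) (h ∘ e.symm) (e q)).comp (mfderiv (𝓡 n) (𝓡 n) e q) := by
    rw [← mfderiv_comp q hcomp he]
    exact hev.mfderiv_eq
  refine ⟨mdifferentiableAt_iff_differentiableAt.1 hcomp, fun v => ?_⟩
  rw [h1]
  simp only [mfderiv_eq_fderiv]
  rfl

theorem differential_eq_fderiv {h : M → ℝ} {c q : M} (hq : q ∈ (chartAt 𝔼 c).source)
    (hh : MDifferentiableAt (𝓡 n) 𝓘(ℝ, ℝ) h q) (v : TangentSpace (𝓡 n) q) :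
    differential h q v
      = fderiv ℝ (h ∘ (chartAt 𝔼 c).symm) (chartAt 𝔼 c q) (chartDeriv c q v) :=
  (mfderiv_eq_fderiv_chart hq hh).2 v

theorem fderiv_eq_sum (φ : 𝔼 → ℝ) (y v : 𝔼) :
    fderiv ℝ φ y v = ∑ i, v i * partialDeriv i φ y := by
  have : v = ∑ i, v i • EuclideanSpace.single i (1 : ℝ) := by
    ext j
    simp [Finset.sum_apply, Pi.single_apply]
  conv_lhs => rw [this]
  simp [partialDeriv]

theorem lieDeriv_symm_eq_sum {V : VField n M} {h : M → ℝ} {c : M} {y : 𝔼}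
    (hy : y ∈ (chartAt 𝔼 c).target)
    (hh : MDifferentiableAt (𝓡 n) 𝓘(ℝ, ℝ) h ((chartAt 𝔼 c).symm y)) :
    lieDeriv V h ((chartAt 𝔼 c).symm y)
      = ∑ i, component c V i y * partialDeriv i (h ∘ (chartAt 𝔼 c).symm) y := by
  rw [lieDeriv, differential_eq_fderiv ((chartAt 𝔼 c).map_target hy) hh,
    (chartAt 𝔼 c).right_inv hy, fderiv_eq_sum]
  rfl

/-! ### Coordinate calculus, the metric matrix and the volume density -/

theorem partialDeriv_mul {φ ψ : 𝔼 → ℝ} {y : 𝔼} (hφ : DifferentiableAt ℝ φ y)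
    (hψ : DifferentiableAt ℝ ψ y) (i : Fin n) :
    partialDeriv i (fun z => φ z * ψ z) y
      = φ y * partialDeriv i ψ y + ψ y * partialDeriv i φ y := by
  simp [partialDeriv, fderiv_fun_mul hφ hψ]

theorem partialDeriv_sum {ι : Type*} {s : Finset ι} {φ : ι → 𝔼 → ℝ} {y : 𝔼}
    (hφ : ∀ a ∈ s, DifferentiableAt ℝ (φ a) y) (i : Fin n) :
    partialDeriv i (fun z => ∑ a ∈ s, φ a z) y = ∑ a ∈ s, partialDeriv i (φ a) y := by
  simp [partialDeriv, fderiv_fun_sum hφ]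

theorem partialDeriv_congr {φ ψ : 𝔼 → ℝ} {y : 𝔼} (h : φ =ᶠ[nhds y] ψ) (i : Fin n) :
    partialDeriv i φ y = partialDeriv i ψ y := by
  simp [partialDeriv, h.fderiv_eq]

/-- Jacobi's formula for the derivative of a determinant. -/
theorem partialDeriv_det {A : 𝔼 → Matrix (Fin n) (Fin n) ℝ} {y : 𝔼}
    (hA : ∀ i j, DifferentiableAt ℝ (fun z => A z i j) y) (m : Fin n) :
    partialDeriv m (fun z => (A z).det) y
      = ∑ i, ∑ k, (A y).adjugate i k * partialDeriv m (fun z => A z k i) y := by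
  -- By Cramer's rule the inner sum is the determinant with column i replaced by its derivative,
  -- which is the i-th term of the product rule.
  have h1 : ∀ i, ∑ k, (A y).adjugate i k * partialDeriv m (fun z => A z k i) y
      = ((A y).updateCol i (fun k => partialDeriv m (fun z => A z k i) y)).det := by
    intro i
    rw [← Matrix.cramer_apply, Matrix.cramer_eq_adjugate_mulVec]
    rfl
  have hprod : ∀ σ : Equiv.Perm (Fin n), DifferentiableAt ℝ (fun z => ∏ i, A z (σ i) i) y :=
    fun σ => (HasFDerivAt.finsetProd (u := Finset.univ) (g := fun i z => A z (σ i) i)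
      fun i _ => (hA (σ i) i).hasFDerivAt).differentiableAt
  simp only [h1, Matrix.det_apply']
  rw [partialDeriv_sum (fun σ _ => (hprod σ).const_mul _), Finset.sum_comm]
  refine Finset.sum_congr rfl fun σ _ => ?_
  rw [partialDeriv, fderiv_const_mul (hprod σ)]
  rw [(HasFDerivAt.finsetProd (u := Finset.univ) (g := fun i z => A z (σ i) i)
    fun i _ => (hA (σ i) i).hasFDerivAt).fderiv]
  simp only [smul_apply, sum_apply, smul_eq_mul, Finset.mul_sum]
  refine Finset.sum_congr rfl fun i _ => ?_
  rw [← Finset.mul_prod_erase _ _ (Finset.mem_univ i), Matrix.updateCol_self,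
    Finset.prod_congr rfl (g := fun j => A y (σ j) j)
      fun j hj => Matrix.updateCol_ne (Finset.ne_of_mem_erase hj), partialDeriv]
  ring

theorem metricMatrix_symm (g : SmoothMetric n M) (c : M) (y : 𝔼) (i j : Fin n) :
    metricMatrix g c y i j = metricMatrix g c y j i :=
  g.symm _ _ _

theorem metricMatrix_posDef (g : SmoothMetric n M) {c : M} {y : 𝔼}
    (hy : y ∈ (chartAt 𝔼 c).target) : (metricMatrix g c y).PosDef := by
  refine .of_dotProduct_mulVec_pos ?_ fun x hx => ?_
  · ext i j
    simp [metricMatrix_symm g c y i j]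
  · have hq := (chartAt 𝔼 c).map_target hy
    set v : TangentSpace (𝓡 n) ((chartAt 𝔼 c).symm y) := ∑ i, x i • coordVector c i _ with hv
    have hne : v ≠ 0 := by
      intro h0
      apply hx
      ext j
      have := congrArg (fun w => (chartDeriv c _ w : 𝔼) j) h0
      simpa [hv, chartDeriv_coordVector hq, Finset.sum_apply, Pi.single_apply] using this
    have hpos := g.pos _ v hne
    rw [hv] at hpos
    refine hpos.trans_eq ?_
    simp only [map_sum, map_smul, sum_apply, smul_apply,
      smul_eq_mul, metricMatrix, dotProduct, Matrix.mulVec, Matrix.of_apply, Finset.mul_sum]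
    rw [Finset.sum_comm]
    refine Finset.sum_congr rfl fun i _ => Finset.sum_congr rfl fun j _ => ?_
    simp only [Pi.star_apply, star_trivial]
    ring

theorem volumeDensity_pos (g : SmoothMetric n M) {c : M} {y : 𝔼}
    (hy : y ∈ (chartAt 𝔼 c).target) : 0 < volumeDensity g c y :=
  Real.sqrt_pos.2 (metricMatrix_posDef g hy).det_pos

theorem det_metricMatrix_contDiffOn (g : SmoothMetric n M) (c : M) :
    ContDiffOn ℝ ∞ (fun y => (metricMatrix g c y).det) (chartAt 𝔼 c).target := by
  simp only [Matrix.det_apply']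
  exact ContDiffOn.sum fun σ _ => contDiffOn_const.mul
    (contDiffOn_prod fun i _ => metricMatrix_contDiffOn g c _ _)

theorem volumeDensity_contDiffOn (g : SmoothMetric n M) (c : M) :
    ContDiffOn ℝ ∞ (volumeDensity g c) (chartAt 𝔼 c).target :=
  (det_metricMatrix_contDiffOn g c).sqrt fun _ hy => (metricMatrix_posDef g hy).det_pos.ne'

set_option linter.unusedSectionVars false in
theorem _root_.ContDiffOn.differentiableAt_chart_target {F : Type*} [NormedAddCommGroup F]
    [NormedSpace ℝ F] {c : M} {φ : 𝔼 → F} (h : ContDiffOn ℝ ∞ φ (chartAt 𝔼 c).target) {y : 𝔼}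
    (hy : y ∈ (chartAt 𝔼 c).target) : DifferentiableAt ℝ φ y :=
  (h.contDiffAt ((chartAt 𝔼 c).open_target.mem_nhds hy)).differentiableAt (by simp)

theorem sum_metricMatrix_mul_inv (g : SmoothMetric n M) {c : M} {y : 𝔼}
    (hy : y ∈ (chartAt 𝔼 c).target) (l m : Fin n) :
    ∑ k, metricMatrix g c y k l * (metricMatrix g c y)⁻¹ k m = if l = m then 1 else 0 := by
  have h := Matrix.mul_nonsing_inv (metricMatrix g c y)
    (isUnit_iff_ne_zero.2 (metricMatrix_posDef g hy).det_pos.ne')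
  have := congrFun (congrFun h l) m
  rw [Matrix.mul_apply, Matrix.one_apply] at this
  rw [← this]
  exact Finset.sum_congr rfl fun k _ => by rw [metricMatrix_symm]

/-- With A the Jacobian matrix of the transition map, the metric matrices satisfy G = Aᵀ G' A; take
determinants and square roots. This is the Jacobian factor in the change of variables between
charts. -/
theorem volumeDensity_chart_change (g : SmoothMetric n M) {c c' : M} {y : 𝔼}
    (hy : y ∈ (chartAt 𝔼 c).target) (hy' : (chartAt 𝔼 c).symm y ∈ (chartAt 𝔼 c').source) :
    HasFDerivAt (chartAt 𝔼 c' ∘ (chartAt 𝔼 c).symm)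
      (fderiv ℝ (chartAt 𝔼 c' ∘ (chartAt 𝔼 c).symm) y) y ∧
    volumeDensity g c y = |(fderiv ℝ (chartAt 𝔼 c' ∘ (chartAt 𝔼 c).symm) y).det|
      * volumeDensity g c' (chartAt 𝔼 c' ((chartAt 𝔼 c).symm y)) := by
  have : IsManifold (𝓡 n) 1 M := .of_le (n := ∞) (by norm_num)
  have hq := (chartAt 𝔼 c).map_target hy
  obtain ⟨h1, h2⟩ := mfderiv_eq_fderiv_chart (F := 𝔼) (h := chartAt 𝔼 c') hq
    (mdifferentiableAt_atlas (chart_mem_atlas 𝔼 c') hy')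
  rw [(chartAt 𝔼 c).right_inv hy] at h1 h2
  refine ⟨h1.hasFDerivAt, ?_⟩
  set J := fderiv ℝ (chartAt 𝔼 c' ∘ (chartAt 𝔼 c).symm) y
  set b := (EuclideanSpace.basisFun (Fin n) ℝ).toBasis
  set A := LinearMap.toMatrix b b (J : 𝔼 →ₗ[ℝ] 𝔼) with hA
  have hAe : ∀ k i, A k i
      = (chartDeriv c' ((chartAt 𝔼 c).symm y) (coordVector c i ((chartAt 𝔼 c).symm y)) : 𝔼) k := by
    intro k i
    have := h2 (coordVector c i ((chartAt 𝔼 c).symm y))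
    rw [chartDeriv_coordVector hq] at this
    rw [hA, LinearMap.toMatrix_apply]
    simp only [b]
    simp only [OrthonormalBasis.coe_toBasis, EuclideanSpace.basisFun_apply,
      OrthonormalBasis.coe_toBasis_repr_apply, EuclideanSpace.basisFun_repr,
      ContinuousLinearMap.coe_coe]
    exact congrArg (fun w : 𝔼 => w k) this.symm
  have hdet : J.det = A.det := by
    rw [hA, LinearMap.det_toMatrix]
  have hl := (chartAt 𝔼 c').left_inv hy'
  have hG' : ∀ i j, metricMatrix g c' (chartAt 𝔼 c' ((chartAt 𝔼 c).symm y)) i j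
      = g.inner ((chartAt 𝔼 c).symm y) (coordVector c' i _) (coordVector c' j _) := fun i j =>
    congrArg (fun q => g.inner q (coordVector c' i q) (coordVector c' j q)) hl
  have hG : metricMatrix g c y = A.transpose
      * metricMatrix g c' (chartAt 𝔼 c' ((chartAt 𝔼 c).symm y)) * A := by
    ext i j
    rw [metricMatrix, Matrix.of_apply, eq_sum_coordVector hy' (coordVector c i _),
      eq_sum_coordVector hy' (coordVector c j _)]
    simp only [← hAe, Matrix.mul_apply, hG', map_sum, map_smul, sum_apply, smul_apply, smul_eq_mul,
      Finset.sum_mul, Finset.mul_sum, Matrix.transpose_apply]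
    refine Finset.sum_congr rfl fun k _ => Finset.sum_congr rfl fun l _ => ?_
    ring
  rw [volumeDensity, volumeDensity, hG, Matrix.det_mul, Matrix.det_mul, Matrix.det_transpose, hdet,
    ← Real.sqrt_sq_eq_abs, ← Real.sqrt_mul (sq_nonneg _)]
  congr 1
  ring

/-! ### Levi-Civita connection and Killing's equation in coordinates -/

/-- The Christoffel symbol of the first kind. -/
def christoffelLow (g : SmoothMetric n M) (c : M) (i j l : Fin n) (y : 𝔼) : ℝ :=
  (1 / 2) * (partialDeriv i (fun z => metricMatrix g c z j l) y
      + partialDeriv j (fun z => metricMatrix g c z i l) y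
      - partialDeriv l (fun z => metricMatrix g c z i j) y)

theorem sum_metricMatrix_mul_christoffel (g : SmoothMetric n M) {c : M} {y : 𝔼}
    (hy : y ∈ (chartAt 𝔼 c).target) (i j l : Fin n) :
    ∑ k, metricMatrix g c y k l * christoffel g c k i j y = christoffelLow g c i j l y := by
  simp only [christoffel, Finset.mul_sum]
  rw [Finset.sum_comm]
  have : ∀ m k, metricMatrix g c y k l * (1 / 2 * ((metricMatrix g c y)⁻¹ k m *
      (partialDeriv i (fun z => metricMatrix g c z j m) y
      + partialDeriv j (fun z => metricMatrix g c z i m) y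
      - partialDeriv m (fun z => metricMatrix g c z i j) y)))
      = (metricMatrix g c y k l * (metricMatrix g c y)⁻¹ k m) * christoffelLow g c i j m y := by
    intro m k
    rw [christoffelLow]
    ring
  simp only [this, ← Finset.sum_mul, sum_metricMatrix_mul_inv g hy]
  simp

/-- The matrix of the bilinear form `(v, w) ↦ g(∇_v X, w)` in the chart around `c`. -/
def covMatrix (g : SmoothMetric n M) (c : M) (X : VField n M) (i l : Fin n) (y : 𝔼) : ℝ :=
  (∑ k, metricMatrix g c y k l * partialDeriv i (component c X k) y)
    + ∑ j, christoffelLow g c i j l y * component c X j y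

set_option linter.unusedSectionVars false in
theorem component_chartAt_self (V : VField n M) (p : M) (i : Fin n) :
    component p V i (chartAt 𝔼 p p) = (chartDeriv p p (V p)) i := by
  have h := (chartAt 𝔼 p).left_inv (mem_chart_source 𝔼 p)
  exact congrArg (fun q => (chartDeriv p q (V q) : 𝔼) i) h

/-- Lowering the index cancels the inverse matrix in the Christoffel symbols, leaving those of the
first kind. Since `covDeriv` at p is computed in the chart around p, this and the Killing identities
built on it are stated at chart centres only, which suffices because p is arbitrary. -/
theorem inner_covDeriv (g : SmoothMetric n M) (V X W : VField n M) (p : M) :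
    g.inner p (covDeriv g V X p) (W p)
      = ∑ i, ∑ l, component p V i (chartAt 𝔼 p p) * component p W l (chartAt 𝔼 p p)
          * covMatrix g p X i l (chartAt 𝔼 p p) := by
  have hp := mem_chart_source 𝔼 p
  have hy := mem_chart_target 𝔼 p
  have hG : ∀ k l, g.inner p (coordVector p k p) (coordVector p l p)
      = metricMatrix g p (chartAt 𝔼 p p) k l := fun k l =>
    (congrArg (fun q => g.inner q (coordVector p k q) (coordVector p l q))
      ((chartAt 𝔼 p).left_inv hp)).symm
  set y := chartAt 𝔼 p p
  have h1 : g.inner p (covDeriv g V X p) (W p)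
      = ∑ l, component p W l y * ∑ k, metricMatrix g p y k l * covComponent g p V X k y := by
    conv_lhs => rw [eq_sum_coordVector hp (W p)]
    simp only [covDeriv, map_sum, map_smul, sum_apply, smul_apply, smul_eq_mul, hG,
      Finset.mul_sum]
    refine Finset.sum_congr rfl fun l _ => Finset.sum_congr rfl fun k _ => ?_
    rw [component_chartAt_self]
    ring
  rw [h1, Finset.sum_comm]
  refine Finset.sum_congr rfl fun l _ => ?_
  have h2 : ∑ k, metricMatrix g p y k l * covComponent g p V X k y
      = ∑ i, component p V i y * covMatrix g p X i l y := by
    simp only [covComponent, covMatrix, mul_add, Finset.sum_add_distrib, Finset.mul_sum]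
    congr 1
    · rw [Finset.sum_comm]
      exact Finset.sum_congr rfl fun i _ => Finset.sum_congr rfl fun k _ => by ring
    · rw [Finset.sum_comm]
      refine Finset.sum_congr rfl fun i _ => ?_
      rw [Finset.sum_comm]
      refine Finset.sum_congr rfl fun j _ => ?_
      rw [← sum_metricMatrix_mul_christoffel g hy, Finset.sum_mul, Finset.mul_sum]
      exact Finset.sum_congr rfl fun k _ => by ring
  rw [h2, Finset.mul_sum]
  exact Finset.sum_congr rfl fun i _ => by ring

/-- Killing's equation is tested on globally smooth fields; a bump function extends coordinate
vectors to such fields, so that the equation can be read entry by entry. -/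
theorem exists_isSmoothField_eq_coordVector [T2Space M] (p : M) (i : Fin n) :
    ∃ V : VField n M, IsSmoothField V ∧ V p = coordVector p i p := by
  let χ : SmoothBumpFunction (𝓡 n) p := Classical.arbitrary _
  refine ⟨fun q => χ q • coordVector p i q, ?_, by simp⟩
  exact ContMDiffOn.smul_section_of_tsupport (ψ := χ) χ.contMDiff.contMDiffOn
    (chartAt 𝔼 p).open_source χ.tsupport_subset_chartAt_source (coordVector_contMDiffOn p i)

theorem IsKilling.covMatrix_skew [T2Space M] {g : SmoothMetric n M} {X : VField n M}
    (hX : IsKilling g X) (p : M) (i l : Fin n) :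
    covMatrix g p X i l (chartAt 𝔼 p p) = -covMatrix g p X l i (chartAt 𝔼 p p) := by
  obtain ⟨V, hV, hVp⟩ := exists_isSmoothField_eq_coordVector p i
  obtain ⟨W, hW, hWp⟩ := exists_isSmoothField_eq_coordVector p l
  have h := hX.2 V W hV hW p
  rw [inner_covDeriv, inner_covDeriv] at h
  simpa [component_chartAt_self, hVp, hWp, chartDeriv_coordVector (mem_chart_source 𝔼 p),
    Pi.single_apply] using h

/-- Metric compatibility of the connection. -/
theorem christoffelLow_add (g : SmoothMetric n M) (c : M) (i j l : Fin n) (y : 𝔼) :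
    christoffelLow g c i j l y + christoffelLow g c l j i y
      = partialDeriv j (fun z => metricMatrix g c z i l) y := by
  simp only [christoffelLow, metricMatrix_symm g c _ l j, metricMatrix_symm g c _ l i,
    metricMatrix_symm g c _ j i]
  ring

/-- This is L_X g = 0 in coordinates: in the symmetric part of `covMatrix`, metric compatibility
turns the Christoffel terms into the derivative of g along X. -/
theorem IsKilling.lie_metricMatrix [T2Space M] {g : SmoothMetric n M} {X : VField n M}
    (hX : IsKilling g X) (p : M) (i l : Fin n) :
    (∑ j, component p X j (chartAt 𝔼 p p)
        * partialDeriv j (fun z => metricMatrix g p z i l) (chartAt 𝔼 p p))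
      + (∑ k, metricMatrix g p (chartAt 𝔼 p p) k l
          * partialDeriv i (component p X k) (chartAt 𝔼 p p))
      + (∑ k, metricMatrix g p (chartAt 𝔼 p p) k i
          * partialDeriv l (component p X k) (chartAt 𝔼 p p)) = 0 := by
  have h := hX.covMatrix_skew p i l
  rw [covMatrix, covMatrix] at h
  have h2 : (∑ j, component p X j (chartAt 𝔼 p p)
        * partialDeriv j (fun z => metricMatrix g p z i l) (chartAt 𝔼 p p))
      = (∑ j, christoffelLow g p i j l (chartAt 𝔼 p p) * component p X j (chartAt 𝔼 p p))
        + ∑ j, christoffelLow g p l j i (chartAt 𝔼 p p) * component p X j (chartAt 𝔼 p p) := by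
    rw [← Finset.sum_add_distrib]
    refine Finset.sum_congr rfl fun j _ => ?_
    rw [← christoffelLow_add]
    ring
  rw [h2]
  linarith

/-- Jacobi's formula, with the adjugate equal to ρ² G⁻¹ for ρ = √det G. -/
theorem partialDeriv_volumeDensity (g : SmoothMetric n M) {c : M} {y : 𝔼}
    (hy : y ∈ (chartAt 𝔼 c).target) (m : Fin n) :
    partialDeriv m (volumeDensity g c) y
      = volumeDensity g c y * ((1 / 2) * ∑ i, ∑ k, (metricMatrix g c y)⁻¹ i k
          * partialDeriv m (fun z => metricMatrix g c z k i) y) := by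
  have hdet := (metricMatrix_posDef g hy).det_pos
  have hd := (det_metricMatrix_contDiffOn g c).differentiableAt_chart_target hy
  have h1 : partialDeriv m (volumeDensity g c) y
      = (1 / (2 * volumeDensity g c y)) * partialDeriv m (fun z => (metricMatrix g c z).det) y := by
    unfold partialDeriv
    have := (hd.hasFDerivAt.sqrt hdet.ne').fderiv
    unfold volumeDensity
    rw [this]
    rfl
  rw [h1, partialDeriv_det fun i j =>
    (metricMatrix_contDiffOn g c i j).differentiableAt_chart_target hy]
  have hadj : ∀ i k, (metricMatrix g c y).adjugate i k
      = volumeDensity g c y ^ 2 * (metricMatrix g c y)⁻¹ i k := by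
    intro i k
    rw [volumeDensity, Real.sq_sqrt hdet.le, Matrix.inv_def, Matrix.smul_apply,
      Ring.inverse_eq_inv', smul_eq_mul, mul_inv_cancel_left₀ hdet.ne']
  simp only [hadj, mul_assoc, ← Finset.mul_sum]
  have := (volumeDensity_pos g hy).ne'
  field_simp

theorem sum_inv_mul_metricMatrix (g : SmoothMetric n M) {c : M} {y : 𝔼}
    (hy : y ∈ (chartAt 𝔼 c).target) (i k : Fin n) :
    ∑ l, (metricMatrix g c y)⁻¹ i l * metricMatrix g c y k l = if i = k then 1 else 0 := by
  have h := Matrix.nonsing_inv_mul (metricMatrix g c y)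
    (isUnit_iff_ne_zero.2 (metricMatrix_posDef g hy).det_pos.ne')
  have := congrFun (congrFun h i) k
  rw [Matrix.mul_apply, Matrix.one_apply] at this
  rw [← this]
  exact Finset.sum_congr rfl fun l _ => by rw [metricMatrix_symm]

theorem inv_metricMatrix_symm (g : SmoothMetric n M) (c : M) (y : 𝔼) (i k : Fin n) :
    (metricMatrix g c y)⁻¹ i k = (metricMatrix g c y)⁻¹ k i := by
  have h : (metricMatrix g c y).transpose = metricMatrix g c y := by
    ext a b
    exact metricMatrix_symm g c y b a
  conv_lhs => rw [← h, ← Matrix.transpose_nonsing_inv]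
  rfl

/-- A Killing field is divergence-free at the centre of each chart. -/
theorem IsKilling.divergence_eq_zero [T2Space M] {g : SmoothMetric n M} {X : VField n M}
    (hX : IsKilling g X) (p : M) :
    ∑ i, (component p X i (chartAt 𝔼 p p) * partialDeriv i (volumeDensity g p) (chartAt 𝔼 p p)
      + volumeDensity g p (chartAt 𝔼 p p) * partialDeriv i (component p X i) (chartAt 𝔼 p p))
      = 0 := by
  have hy := mem_chart_target 𝔼 p
  set y := chartAt 𝔼 p p
  -- Trace of L_X g = 0 against g⁻¹. The first summand becomes 2 X(ρ)/ρ, and each of the other two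
  -- becomes ∑ ∂ᵢXⁱ.
  have key : ∑ i, ∑ l, (metricMatrix g p y)⁻¹ i l *
      ((∑ j, component p X j y * partialDeriv j (fun z => metricMatrix g p z i l) y)
      + (∑ k, metricMatrix g p y k l * partialDeriv i (component p X k) y)
      + (∑ k, metricMatrix g p y k i * partialDeriv l (component p X k) y)) = 0 :=
    Finset.sum_eq_zero fun i _ => Finset.sum_eq_zero fun l _ => by
      rw [hX.lie_metricMatrix p i l, mul_zero]
  have h2 : ∑ i, ∑ l, (metricMatrix g p y)⁻¹ i l *
      (∑ k, metricMatrix g p y k l * partialDeriv i (component p X k) y)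
      = ∑ i, partialDeriv i (component p X i) y := by
    refine Finset.sum_congr rfl fun i _ => ?_
    simp only [Finset.mul_sum, ← mul_assoc]
    rw [Finset.sum_comm]
    simp only [← Finset.sum_mul, sum_inv_mul_metricMatrix g hy]
    simp
  have h3 : ∑ i, ∑ l, (metricMatrix g p y)⁻¹ i l *
      (∑ k, metricMatrix g p y k i * partialDeriv l (component p X k) y)
      = ∑ i, partialDeriv i (component p X i) y := by
    rw [← h2, Finset.sum_comm]
    exact Finset.sum_congr rfl fun i _ => Finset.sum_congr rfl fun l _ => by
      rw [inv_metricMatrix_symm]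
  have h1 : ∑ i, ∑ l, (metricMatrix g p y)⁻¹ i l *
      (∑ j, component p X j y * partialDeriv j (fun z => metricMatrix g p z i l) y)
      = ∑ j, component p X j y * ∑ i, ∑ k, (metricMatrix g p y)⁻¹ i k
          * partialDeriv j (fun z => metricMatrix g p z k i) y := by
    simp only [Finset.mul_sum]
    conv_rhs => rw [Finset.sum_comm]
    refine Finset.sum_congr rfl fun i _ => ?_
    conv_rhs => rw [Finset.sum_comm]
    refine Finset.sum_congr rfl fun l _ => Finset.sum_congr rfl fun j _ => ?_
    simp only [metricMatrix_symm g p _ i l]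
    ring
  simp only [mul_add, Finset.sum_add_distrib] at key
  rw [h1, h2, h3] at key
  simp only [partialDeriv_volumeDensity g hy, Finset.sum_add_distrib, ← Finset.mul_sum]
  have h4 : ∑ j, component p X j y * (volumeDensity g p y * (1 / 2 * ∑ i, ∑ k,
      (metricMatrix g p y)⁻¹ i k * partialDeriv j (fun z => metricMatrix g p z k i) y))
      = volumeDensity g p y * (1 / 2) * ∑ j, component p X j y * ∑ i, ∑ k,
      (metricMatrix g p y)⁻¹ i k * partialDeriv j (fun z => metricMatrix g p z k i) y := by
    rw [Finset.mul_sum]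
    exact Finset.sum_congr rfl fun j _ => by ring
  rw [h4]
  linear_combination volumeDensity g p y * (1 / 2) * key

/-! ### Zonal flows and the ratio F -/

set_option linter.unusedSectionVars false in
theorem component_smul_field (c : M) (f : M → ℝ) (X : VField n M) (i : Fin n) :
    component c (fun p => f p • X p) i
      = fun y => (f ∘ (chartAt 𝔼 c).symm) y * component c X i y := by
  ext y
  simp [component]

set_option linter.unusedSectionVars false in
theorem IsSmoothFun.mdifferentiableAt {h : M → ℝ} (hh : IsSmoothFun n h) (p : M) :
    MDifferentiableAt (𝓡 n) 𝓘(ℝ, ℝ) h p :=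
  (hh p).mdifferentiableAt (by simp)

/-- div(fX) = X(f) + f div X, and div X = 0. -/
theorem IsKilling.lieDeriv_eq_zero [T2Space M] {g : SmoothMetric n M} {X : VField n M}
    (hX : IsKilling g X) {f : M → ℝ} (hf : IsSmoothFun n f)
    (hdiv : IsDivergenceFree g (fun p => f p • X p)) (p : M) : lieDeriv X f p = 0 := by
  have hy := mem_chart_target 𝔼 p
  have h0 := hX.divergence_eq_zero p
  have hdiv := hdiv p _ hy
  have hl := lieDeriv_symm_eq_sum (V := X) hy (hf.mdifferentiableAt _)
  rw [(chartAt 𝔼 p).left_inv (mem_chart_source 𝔼 p)] at hl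
  rw [hl]
  set y := chartAt 𝔼 p p
  have hρ := volumeDensity_pos g hy
  rw [chartDivergence, mul_eq_zero, or_iff_right (inv_ne_zero hρ.ne')] at hdiv
  have hfd := (hf.contDiffOn p).differentiableAt_chart_target hy
  have hXd := fun i => (hX.1.component_contDiffOn p i).differentiableAt_chart_target hy
  have hρd := (volumeDensity_contDiffOn g p).differentiableAt_chart_target hy
  have : ∀ i, partialDeriv i
      (fun z => volumeDensity g p z * component p (fun p => f p • X p) i z) y
      = volumeDensity g p y * (component p X i y * partialDeriv i (f ∘ (chartAt 𝔼 p).symm) y)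
        + (f ∘ (chartAt 𝔼 p).symm) y * (component p X i y * partialDeriv i (volumeDensity g p) y
          + volumeDensity g p y * partialDeriv i (component p X i) y) := by
    intro i
    rw [component_smul_field, partialDeriv_mul hρd (hfd.fun_mul (hXd i)),
      partialDeriv_mul hfd (hXd i)]
    ring
  simp only [this, Finset.sum_add_distrib (f := fun i => volumeDensity g p y * _),
    ← Finset.mul_sum, h0] at hdiv
  simpa [hρ.ne'] using hdiv

/-- The identity ∂ₗ g(X,X) = 2 g(∇ₗX, X), valid for any smooth field. -/
theorem partialDeriv_normSq (g : SmoothMetric n M) {X : VField n M} (hX : IsSmoothField X)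
    {c : M} {y : 𝔼} (hy : y ∈ (chartAt 𝔼 c).target) (l : Fin n) :
    partialDeriv l (normSq g X ∘ (chartAt 𝔼 c).symm) y
      = 2 * ∑ i, component c X i y * covMatrix g c X l i y := by
  have hXd := fun i => (hX.component_contDiffOn c i).differentiableAt_chart_target hy
  have hGd := fun i j => (metricMatrix_contDiffOn g c i j).differentiableAt_chart_target hy
  have h1 : normSq g X ∘ (chartAt 𝔼 c).symm =ᶠ[nhds y] fun z =>
      ∑ i, ∑ j, metricMatrix g c z i j * component c X i z * component c X j z := by
    filter_upwards [(chartAt 𝔼 c).open_target.mem_nhds hy] with z hz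
    exact metric_eq_sum g X X hz
  rw [partialDeriv_congr h1, partialDeriv_sum fun i _ =>
    DifferentiableAt.fun_sum fun j _ => ((hGd i j).fun_mul (hXd i)).fun_mul (hXd j)]
  have h2 : ∀ i, partialDeriv l (fun z => ∑ j, metricMatrix g c z i j * component c X i z
        * component c X j z) y
      = ∑ j, (component c X i y * component c X j y
            * partialDeriv l (fun z => metricMatrix g c z i j) y
          + component c X j y * (metricMatrix g c y i j * partialDeriv l (component c X i) y)
          + component c X i y * (metricMatrix g c y i j * partialDeriv l (component c X j) y)) := by
    intro i
    rw [partialDeriv_sum fun j _ => ((hGd i j).fun_mul (hXd i)).fun_mul (hXd j)]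
    refine Finset.sum_congr rfl fun j _ => ?_
    rw [partialDeriv_mul ((hGd i j).fun_mul (hXd i)) (hXd j), partialDeriv_mul (hGd i j) (hXd i)]
    ring
  simp only [h2, covMatrix, Finset.sum_add_distrib, mul_add, christoffelLow, Finset.mul_sum]
  have h3 : ∑ i, ∑ j, component c X j y * (metricMatrix g c y i j
        * partialDeriv l (component c X i) y)
      = ∑ i, ∑ j, component c X i y * (metricMatrix g c y j i
        * partialDeriv l (component c X j) y) := Finset.sum_comm
  have h4 : ∑ i, ∑ j, component c X i y * (metricMatrix g c y i j
        * partialDeriv l (component c X j) y)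
      = ∑ i, ∑ j, component c X i y * (metricMatrix g c y j i
        * partialDeriv l (component c X j) y) :=
    Finset.sum_congr rfl fun i _ => Finset.sum_congr rfl fun j _ => by rw [metricMatrix_symm]
  -- Two of the three Christoffel terms cancel against the symmetric weight XⁱXʲ; only ∂ₗ gᵢⱼ
  -- survives.
  have h5 : ∑ i, ∑ j, component c X i y * component c X j y
        * partialDeriv j (fun z => metricMatrix g c z l i) y
      = ∑ i, ∑ j, component c X i y * component c X j y
        * partialDeriv i (fun z => metricMatrix g c z l j) y := by
    rw [Finset.sum_comm]
    exact Finset.sum_congr rfl fun i _ => Finset.sum_congr rfl fun j _ => by ring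
  have h6 : ∑ i, ∑ j, 2 * (component c X i y * (1 / 2 *
        (partialDeriv l (fun z => metricMatrix g c z j i) y
          + partialDeriv j (fun z => metricMatrix g c z l i) y
          - partialDeriv i (fun z => metricMatrix g c z l j) y) * component c X j y))
      = ∑ i, ∑ j, component c X i y * component c X j y
          * partialDeriv l (fun z => metricMatrix g c z i j) y := by
    rw [← sub_eq_zero, ← Finset.sum_sub_distrib]
    rw [← sub_eq_zero, ← Finset.sum_sub_distrib] at h5
    rw [← h5]
    refine Finset.sum_congr rfl fun i _ => ?_
    rw [← Finset.sum_sub_distrib, ← Finset.sum_sub_distrib]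
    refine Finset.sum_congr rfl fun j _ => ?_
    simp only [metricMatrix_symm g c _ j i]
    ring
  have h7 : ∑ i, ∑ j, 2 * (component c X i y * (metricMatrix g c y j i
        * partialDeriv l (component c X j) y))
      = 2 * ∑ i, ∑ j, component c X i y * (metricMatrix g c y j i
        * partialDeriv l (component c X j) y) := by
    simp only [Finset.mul_sum]
  rw [h3, h4, h6, h7]
  ring

/-- `∇_X X = -½ grad ‖X‖²` for a Killing field `X`. -/
theorem IsKilling.inner_covDeriv_self [T2Space M] {g : SmoothMetric n M} {X : VField n M}
    (hX : IsKilling g X) (W : VField n M) (p : M) :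
    g.inner p (covDeriv g X X p) (W p) = -(1 / 2) * lieDeriv W (normSq g X) p := by
  have hy := mem_chart_target 𝔼 p
  have hs : MDifferentiableAt (𝓡 n) 𝓘(ℝ, ℝ) (normSq g X) ((chartAt 𝔼 p).symm (chartAt 𝔼 p p)) :=
    IsSmoothFun.mdifferentiableAt
      (contMDiffOn_univ.1 (metric_contMDiffOn g hX.1.contMDiffOn hX.1.contMDiffOn)) _
  have hl := lieDeriv_symm_eq_sum (V := W) hy hs
  rw [(chartAt 𝔼 p).left_inv (mem_chart_source 𝔼 p)] at hl
  rw [hl, inner_covDeriv, Finset.sum_comm, Finset.mul_sum]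
  refine Finset.sum_congr rfl fun l _ => ?_
  rw [partialDeriv_normSq g hX.1 hy, Finset.mul_sum, Finset.mul_sum, Finset.mul_sum]
  refine Finset.sum_congr rfl fun i _ => ?_
  -- Killing's equation in the form g(∇_X X, W) = -g(∇_W X, X).
  rw [hX.covMatrix_skew p i l]
  ring

/-- The only term beyond tensoriality is f X(f) X, which vanishes. -/
theorem covDeriv_smul_self (g : SmoothMetric n M) {X : VField n M} (hX : IsSmoothField X)
    {f : M → ℝ} (hf : IsSmoothFun n f) {p : M} (hXf : lieDeriv X f p = 0) :
    covDeriv g (fun q => f q • X q) (fun q => f q • X q) p = f p ^ 2 • covDeriv g X X p := by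
  have hy := mem_chart_target 𝔼 p
  have hl := lieDeriv_symm_eq_sum (V := X) hy (hf.mdifferentiableAt _)
  have hp := (chartAt 𝔼 p).left_inv (mem_chart_source 𝔼 p)
  rw [hp, hXf] at hl
  simp only [covDeriv, Finset.smul_sum, smul_smul]
  refine Finset.sum_congr rfl fun k _ => ?_
  congr 1
  have hfp : f p = (f ∘ (chartAt 𝔼 p).symm) (chartAt 𝔼 p p) := (congrArg f hp).symm
  rw [hfp]
  set y := chartAt 𝔼 p p
  have hfd := (hf.contDiffOn p).differentiableAt_chart_target hy
  have hXd := fun i => (hX.component_contDiffOn p i).differentiableAt_chart_target hy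
  simp only [covComponent, component_smul_field]
  set φ := f ∘ (chartAt 𝔼 p).symm
  simp only [partialDeriv_mul hfd (hXd _), mul_add, Finset.sum_add_distrib, Finset.mul_sum]
  have h1 : ∑ i, φ y * component p X i y * (component p X k y * partialDeriv i φ y) = 0 := by
    have : ∀ i, φ y * component p X i y * (component p X k y * partialDeriv i φ y)
      = φ y * component p X k y * (component p X i y * partialDeriv i φ y) := fun i => by ring
    simp only [this, ← Finset.mul_sum, ← hl, mul_zero]
  rw [h1, add_zero]
  congr 1
  · exact Finset.sum_congr rfl fun i _ => by ring
  · exact Finset.sum_congr rfl fun i _ => Finset.sum_congr rfl fun j _ => by ring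

theorem IsSmoothField.normSq_isSmoothFun (g : SmoothMetric n M) {X : VField n M}
    (hX : IsSmoothField X) : IsSmoothFun n (normSq g X) :=
  contMDiffOn_univ.1 (metric_contMDiffOn g hX.contMDiffOn hX.contMDiffOn)

theorem IsZonalFlow.sq_mul_differential_normSq [T2Space M] {g : SmoothMetric n M}
    {X : VField n M} {f : M → ℝ} (hZ : IsZonalFlow g (fun p => f p • X p)) (hX : IsKilling g X)
    (hf : IsSmoothFun n f) :
    ∃ P : M → ℝ, IsSmoothFun n P ∧ ∀ p (v : TangentSpace (𝓡 n) p),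
      f p ^ 2 * differential (normSq g X) p v = 2 * differential P p v := by
  classical
  obtain ⟨-, hdiv, P, hP, hPZ⟩ := hZ
  refine ⟨P, hP, fun p v => ?_⟩
  have h1 := hPZ p
  rw [covDeriv_smul_self g hX.1 hf (hX.lieDeriv_eq_zero hf hdiv p)] at h1
  -- The test field enters only through its value at p, so it need not be smooth.
  have h2 := hX.inner_covDeriv_self (Function.update 0 p v) p
  have h3 := congrArg (fun w => g.inner p w v) h1
  simp only [Function.update_self, lieDeriv, map_smul, smul_apply, smul_eq_mul, map_neg, neg_apply,
    inner_gradient] at h2 h3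
  rw [h2] at h3
  linarith

/-- If `φ dη = dψ` then `dφ ∧ dη = 0`. -/
theorem fderiv_mul_fderiv_comm {E : Type*} [NormedAddCommGroup E] [NormedSpace ℝ E]
    {φ η ψ : E → ℝ} {s : Set E} (hs : IsOpen s) (hφ : ContDiffOn ℝ ∞ φ s)
    (hη : ContDiffOn ℝ ∞ η s) (hψ : ContDiffOn ℝ ∞ ψ s)
    (h : ∀ y ∈ s, φ y • fderiv ℝ η y = fderiv ℝ ψ y) {y : E} (hy : y ∈ s) (u v : E) :
    fderiv ℝ φ y u * fderiv ℝ η y v = fderiv ℝ φ y v * fderiv ℝ η y u := by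
  have hsy := hs.mem_nhds hy
  have h2 : (2 : WithTop ℕ∞) ≤ ∞ := WithTop.coe_le_coe.2 (le_top : (2 : ℕ∞) ≤ ⊤)
  have hd : ∀ {ψ : E → ℝ}, ContDiffOn ℝ ∞ ψ s → DifferentiableAt ℝ (fderiv ℝ ψ) y := fun hψ =>
    ((hψ.fderiv_of_isOpen hs (m := 1) h2).contDiffAt hsy).differentiableAt (by simp)
  have hsymm : ∀ {ψ : E → ℝ}, ContDiffOn ℝ ∞ ψ s → IsSymmSndFDerivAt ℝ ψ y := fun hψ =>
    (hψ.contDiffAt hsy).isSymmSndFDerivAt (by simpa using h2)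
  have h1 : (fun z => φ z • fderiv ℝ η z) =ᶠ[nhds y] fderiv ℝ ψ := by
    filter_upwards [hsy] with z hz using h z hz
  -- Differentiating gives dφ(u) dη(v) + φ D²η(u,v) = D²ψ(u,v). Swapping u and v and subtracting
  -- removes the symmetric second derivatives.
  have h2 := h1.fderiv_eq (𝕜 := ℝ)
  rw [fderiv_fun_smul ((hφ.contDiffAt hsy).differentiableAt (by simp)) (hd hη)] at h2
  have huv := congrArg (fun L => L u v) h2
  have hvu := congrArg (fun L => L v u) h2
  simp only [add_apply, smul_apply, ContinuousLinearMap.smulRight_apply, smul_eq_mul] at huv hvu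
  have s1 := hsymm hη u v
  have s2 := hsymm hψ u v
  rw [s1] at huv
  linarith

theorem gradient_eq_smul_of_differential_eq (g : SmoothMetric n M) {φ η : M → ℝ} {p : M} {a : ℝ}
    (h : ∀ v : TangentSpace (𝓡 n) p, differential φ p v = a * differential η p v) :
    gradient g φ p = a • gradient g η p := by
  rw [gradient, gradient, ← map_smul]
  congr 1
  ext v
  exact h v

theorem exists_differential_ne_zero (g : SmoothMetric n M) {η : M → ℝ} {p : M}
    (h : gradient g η p ≠ 0) : ∃ v : TangentSpace (𝓡 n) p, differential η p v ≠ 0 := by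
  refine ⟨gradient g η p, ?_⟩
  rw [← inner_gradient]
  exact (g.pos p _ h).ne'

theorem IsZonalFlow.exists_isGradRatio [T2Space M] {g : SmoothMetric n M} {X : VField n M}
    {f : M → ℝ} (hZ : IsZonalFlow g (fun p => f p • X p)) (hX : IsKilling g X)
    (hf : IsSmoothFun n f) : ∃ F : M → ℝ, IsGradRatio g f X F := by
  obtain ⟨P, hP, h⟩ := hZ.sq_mul_differential_normSq hX hf
  have hη := hX.1.normSq_isSmoothFun g
  have hf2 : IsSmoothFun n (fun q => f q ^ 2) := hf.pow 2
  suffices H : ∀ p, ∃ a : ℝ, p ∈ regularSet g X →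
      gradient g (fun q => f q ^ 2) p = a • gradient g (normSq g X) p by
    choose F hF using H
    exact ⟨F, hF⟩
  intro p
  by_cases hp : p ∈ regularSet g X
  · obtain ⟨v, hv⟩ := exists_differential_ne_zero g hp
    -- The ratio is read off on one vector v with dη(v) ≠ 0; that it serves for every u is d(f²) ∧
    -- dη = 0.
    refine ⟨differential (fun q => f q ^ 2) p v / differential (normSq g X) p v, fun _ =>
      gradient_eq_smul_of_differential_eq g fun u => ?_⟩
    have hps := mem_chart_source 𝔼 p
    rw [div_mul_eq_mul_div, eq_div_iff hv]
    rw [differential_eq_fderiv hps (hf2.mdifferentiableAt p),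
      differential_eq_fderiv hps (hη.mdifferentiableAt p),
      differential_eq_fderiv hps (hf2.mdifferentiableAt p),
      differential_eq_fderiv hps (hη.mdifferentiableAt p)]
    refine fderiv_mul_fderiv_comm (ψ := fun y => 2 * (P ∘ (chartAt 𝔼 p).symm) y)
      (chartAt 𝔼 p).open_target (hf2.contDiffOn p) (hη.contDiffOn p)
      (contDiffOn_const.mul (hP.contDiffOn p)) (fun y hy => ?_) (mem_chart_target 𝔼 p) _ _
    have hq := (chartAt 𝔼 p).map_target hy
    ext w
    obtain ⟨w', rfl⟩ := (chartDeriv_isInvertible hq).surjective w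
    have hw := h _ w'
    rw [differential_eq_fderiv hq (hη.mdifferentiableAt _),
      differential_eq_fderiv hq (hP.mdifferentiableAt _), (chartAt 𝔼 p).right_inv hy] at hw
    rw [fderiv_const_mul ((hP.contDiffOn p).differentiableAt_chart_target hy)]
    exact hw
  · exact ⟨0, fun h => absurd h hp⟩

/-! ### The Riemannian volume measure -/

/-- Gluing of a family of measures that agree on intersections of their domains. -/
theorem iSup_measure_restrict {ι α : Type*} [MeasurableSpace α] (μ : ι → Measure α)
    (U : ι → Set α) (hU : ∀ i, MeasurableSet (U i)) (hμ : ∀ i, (μ i).restrict (U i) = μ i)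
    (hag : ∀ i j s, MeasurableSet s → s ⊆ U i ∩ U j → (μ i).restrict s = (μ j).restrict s)
    {c : ℕ → ι} (hc : ⋃ k, U (c k) = Set.univ) (a : ι) :
    (⨆ i, μ i).restrict (U a) = μ a := by
  set D := disjointed fun k => U (c k)
  have hD : ∀ k, MeasurableSet (D k) := .disjointed fun k => hU (c k)
  have hDU : ∀ k, D k ⊆ U (c k) := disjointed_subset _
  have hDd : Pairwise (Function.onFun Disjoint D) := disjoint_disjointed _
  -- The glued measure, built on disjoint pieces of a countable cover. It restricts to each μ b on U
  -- b, hence dominates every member of the family and so the supremum.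
  set ν : Measure α := Measure.sum fun k => (μ (c k)).restrict (D k) with hν
  have hνr : ∀ b, ν.restrict (U b) = μ b := by
    intro b
    rw [hν, Measure.restrict_sum _ (hU b)]
    have h1 : ∀ k, ((μ (c k)).restrict (D k)).restrict (U b)
        = (μ b).restrict (U b ∩ D k) := fun k => by
      rw [Measure.restrict_restrict (hU b)]
      exact hag _ _ _ ((hU b).inter (hD k)) fun x hx => ⟨hDU k hx.2, hx.1⟩
    simp only [h1]
    rw [← Measure.restrict_iUnion (hDd.mono fun i j h => h.mono Set.inter_subset_right
      Set.inter_subset_right) fun k => (hU b).inter (hD k), ← Set.inter_iUnion, iUnion_disjointed,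
      hc, Set.inter_univ, hμ]
  refine le_antisymm ?_ ?_
  · have : (⨆ i, μ i) ≤ ν := iSup_le fun i => (hνr i).symm.le.trans Measure.restrict_le_self
    exact (Measure.restrict_mono le_rfl this).trans (hνr a).le
  · conv_lhs => rw [← hμ a]
    exact Measure.restrict_mono le_rfl (le_iSup μ a)

section Volume

variable [MeasurableSpace M] [BorelSpace M]

/-- The Riemannian volume of the domain of the chart around `c`, extended by zero. -/
def chartMeasure (g : SmoothMetric n M) (c : M) : Measure M :=
  ((volume.restrict (chartAt 𝔼 c).target).withDensity
    (fun y => ENNReal.ofReal (volumeDensity g c y))).map (chartAt 𝔼 c).symm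

theorem aemeasurable_chart_symm (g : SmoothMetric n M) (c : M) :
    AEMeasurable (chartAt 𝔼 c).symm ((volume.restrict (chartAt 𝔼 c).target).withDensity
      (fun y => ENNReal.ofReal (volumeDensity g c y))) :=
  ((chartAt 𝔼 c).continuousOn_symm.aemeasurable (chartAt 𝔼 c).open_target.measurableSet).mono_ac
    (withDensity_absolutelyContinuous _ _)

set_option linter.unusedSectionVars false in
theorem measurableSet_target_inter_preimage (c : M) {s : Set M} (hs : MeasurableSet s) :
    MeasurableSet ((chartAt 𝔼 c).target ∩ (chartAt 𝔼 c).symm ⁻¹' s) := by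
  have h := (continuousOn_iff_continuous_domRestrict.1 (chartAt 𝔼 c).continuousOn_symm).measurable
  convert! (chartAt 𝔼 c).open_target.measurableSet.subtype_image (h hs)
  ext y
  simp [and_comm]

theorem chartMeasure_apply (g : SmoothMetric n M) (c : M) {s : Set M} (hs : MeasurableSet s) :
    chartMeasure g c s = ∫⁻ y in (chartAt 𝔼 c).target ∩ (chartAt 𝔼 c).symm ⁻¹' s,
      ENNReal.ofReal (volumeDensity g c y) := by
  rw [chartMeasure, Measure.map_apply_of_aemeasurable (aemeasurable_chart_symm g c) hs]
  have hm := measurableSet_target_inter_preimage (n := n) c hs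
  have h0 : (volume.restrict (chartAt 𝔼 c).target).withDensity
      (fun y => ENNReal.ofReal (volumeDensity g c y)) (chartAt 𝔼 c).targetᶜ = 0 :=
    withDensity_absolutelyContinuous _ _ (by
      rw [Measure.restrict_apply (chartAt 𝔼 c).open_target.measurableSet.compl]; simp)
  have h1 := measure_inter_add_sdiff₀ (μ := (volume.restrict (chartAt 𝔼 c).target).withDensity
      (fun y => ENNReal.ofReal (volumeDensity g c y))) ((chartAt 𝔼 c).symm ⁻¹' s)
      (chartAt 𝔼 c).open_target.measurableSet.nullMeasurableSet
  rw [measure_mono_null (s := (chartAt 𝔼 c).symm ⁻¹' s \ (chartAt 𝔼 c).target)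
    (fun x hx => hx.2) h0, add_zero, Set.inter_comm] at h1
  rw [← h1, withDensity_apply _ hm, Measure.restrict_restrict hm,
    Set.inter_eq_left.2 Set.inter_subset_left]

/-- Change of variables along the transition map, whose Jacobian is absorbed by
`volumeDensity_chart_change`. -/
theorem chartMeasure_eq_of_subset (g : SmoothMetric n M) (c c' : M) {s : Set M}
    (hs : MeasurableSet s) (hsub : s ⊆ (chartAt 𝔼 c).source ∩ (chartAt 𝔼 c').source) :
    chartMeasure g c s = chartMeasure g c' s := by
  rw [chartMeasure_apply g c hs, chartMeasure_apply g c' hs]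
  set e := chartAt 𝔼 c
  set e' := chartAt 𝔼 c'
  set T := e.target ∩ e.symm ⁻¹' s
  have hT : MeasurableSet T := measurableSet_target_inter_preimage (n := n) c hs
  have him : (e' ∘ e.symm) '' T = e'.target ∩ e'.symm ⁻¹' s := by
    ext z
    constructor
    · rintro ⟨y, ⟨-, hy⟩, rfl⟩
      have h := (hsub hy).2
      refine ⟨e'.map_source h, ?_⟩
      simpa [e'.left_inv h] using hy
    · rintro ⟨hz, hzs⟩
      have h := (hsub hzs).1
      refine ⟨e (e'.symm z), ⟨e.map_source h, ?_⟩, ?_⟩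
      · simpa [e.left_inv h] using hzs
      · simp [e.left_inv h, e'.right_inv hz]
  have hinj : Set.InjOn (e' ∘ e.symm) T := by
    intro y hy z hz h
    exact e.symm.injOn hy.1 hz.1 (e'.injOn (hsub hy.2).2 (hsub hz.2).2 h)
  rw [← him, lintegral_image_eq_lintegral_abs_det_fderiv_mul volume hT
    (fun y hy => (volumeDensity_chart_change g hy.1 (hsub hy.2).2).1.hasFDerivWithinAt) hinj]
  refine setLIntegral_congr_fun hT fun y hy => ?_
  simp only [(volumeDensity_chart_change g hy.1 (hsub hy.2).2).2,
    ENNReal.ofReal_mul (abs_nonneg _)]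
  rfl

/-- The defining supremum runs over all points of M; compactness supplies the countable subcover
needed for gluing. -/
theorem volumeMeasure_restrict_source [CompactSpace M] (g : SmoothMetric n M) (c : M) :
    (volumeMeasure g).restrict (chartAt 𝔼 c).source = chartMeasure g c := by
  obtain ⟨t, ht, htU⟩ := countable_cover_nhds_of_sigmaCompact
    fun x : M => (chartAt 𝔼 x).open_source.mem_nhds (mem_chart_source 𝔼 x)
  have htne : t.Nonempty := by
    by_contra h
    rw [Set.not_nonempty_iff_eq_empty] at h
    rw [h, Set.biUnion_empty] at htU
    exact (htU ▸ Set.mem_univ c : c ∈ (∅ : Set M))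
  obtain ⟨k, rfl⟩ := ht.exists_eq_range htne
  refine iSup_measure_restrict (chartMeasure g) (fun c => (chartAt 𝔼 c).source)
    (fun c => (chartAt 𝔼 c).open_source.measurableSet) (fun i => ?_) (fun i j s hs hsub => ?_)
    (c := k) (by simpa using htU) c
  · ext s hs
    rw [Measure.restrict_apply hs, chartMeasure_apply g i hs, chartMeasure_apply g i
      (hs.inter (chartAt 𝔼 i).open_source.measurableSet)]
    congr 2
    ext y
    simp only [Set.mem_inter_iff, Set.mem_preimage]
    exact ⟨fun h => ⟨h.1, h.2.1⟩, fun h => ⟨h.1, h.2, (chartAt 𝔼 i).map_target h.1⟩⟩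
  · ext u hu
    rw [Measure.restrict_apply hu, Measure.restrict_apply hu]
    exact chartMeasure_eq_of_subset g i j (hu.inter hs) (Set.inter_subset_right.trans hsub)

theorem volumeMeasure_apply_of_subset [CompactSpace M] (g : SmoothMetric n M) (c : M) {s : Set M}
    (hs : s ⊆ (chartAt 𝔼 c).source) : volumeMeasure g s = chartMeasure g c s := by
  rw [← volumeMeasure_restrict_source, Measure.restrict_eq_self _ hs]

/-- Each point has a neighbourhood whose chart image lies in a closed ball inside the chart target,
where the density is integrable; compactness does the rest. -/
theorem volumeMeasure_isFiniteMeasure [CompactSpace M] (g : SmoothMetric n M) :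
    IsFiniteMeasure (volumeMeasure g) := by
  refine ⟨isCompact_univ.measure_lt_top_of_nhdsWithin fun p _ => ?_⟩
  rw [nhdsWithin_univ]
  set e := chartAt 𝔼 p
  have hy := mem_chart_target 𝔼 p
  obtain ⟨r, hr, hsub⟩ := Metric.nhds_basis_closedBall.mem_iff.1 (e.open_target.mem_nhds hy)
  have hNo : IsOpen (e.source ∩ e ⁻¹' Metric.ball (e p) r) :=
    e.isOpen_inter_preimage Metric.isOpen_ball
  refine ⟨e.source ∩ e ⁻¹' Metric.ball (e p) r,
    hNo.mem_nhds ⟨mem_chart_source 𝔼 p, Metric.mem_ball_self hr⟩, ?_⟩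
  rw [volumeMeasure_apply_of_subset g p Set.inter_subset_left,
    chartMeasure_apply g p hNo.measurableSet]
  have hc : ContinuousOn (volumeDensity g p) (Metric.closedBall (e p) r) :=
    (volumeDensity_contDiffOn g p).continuousOn.mono hsub
  have hint := hc.integrableOn_compact (μ := volume) (isCompact_closedBall _ _)
  refine lt_of_le_of_lt (lintegral_mono_set ?_) (Integrable.lintegral_lt_top hint)
  rintro y ⟨hy1, -, hy2⟩
  rw [Set.mem_preimage, e.right_inv hy1] at hy2
  exact Metric.ball_subset_closedBall hy2

theorem volumeMeasure_isOpenPosMeasure [CompactSpace M] (g : SmoothMetric n M) :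
    (volumeMeasure g).IsOpenPosMeasure := by
  refine ⟨fun U hU ⟨p, hp⟩ h0 => ?_⟩
  set e := chartAt 𝔼 p
  have h1 : volumeMeasure g (U ∩ e.source) = 0 := measure_mono_null Set.inter_subset_left h0
  have hV := (hU.inter e.open_source)
  rw [volumeMeasure_apply_of_subset g p Set.inter_subset_right,
    chartMeasure_apply g p hV.measurableSet] at h1
  have hO : IsOpen (e.target ∩ e.symm ⁻¹' (U ∩ e.source)) := e.symm.isOpen_inter_preimage hV
  have hd : AEMeasurable (fun y => ENNReal.ofReal (volumeDensity g p y))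
      (volume.restrict (e.target ∩ e.symm ⁻¹' (U ∩ e.source))) :=
    (((volumeDensity_contDiffOn g p).continuousOn.mono Set.inter_subset_left).aemeasurable
      hO.measurableSet).ennreal_ofReal
  rw [lintegral_eq_zero_iff' hd, Filter.EventuallyEq, ae_restrict_iff' hO.measurableSet] at h1
  have h2 : volume (e.target ∩ e.symm ⁻¹' (U ∩ e.source)) = 0 := by
    refine measure_mono_null (fun y hy => ?_) h1
    have := volumeDensity_pos g hy.1
    simpa [this] using hy
  refine (hO.measure_pos volume ⟨e p, mem_chart_target 𝔼 p, ?_⟩).ne' h2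
  have := e.left_inv (mem_chart_source 𝔼 p)
  simp only [Set.mem_preimage]
  rw [this]
  exact ⟨hp, mem_chart_source 𝔼 p⟩

end Volume

/-! ### The divergence theorem -/

theorem integral_partialDeriv_eq_zero {w : 𝔼 → ℝ} (hw : ContDiff ℝ 1 w)
    (hc : HasCompactSupport w) (i : Fin n) :
    Integrable (partialDeriv i w) ∧ ∫ y, partialDeriv i w y = 0 := by
  have hcont : Continuous (partialDeriv i w) :=
    (hw.continuous_fderiv (by simp)).clm_apply continuous_const
  have hint : Integrable (partialDeriv i w) :=
    hcont.integrable_of_hasCompactSupport (hc.fderiv_apply ℝ _)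
  refine ⟨hint, ?_⟩
  have h := integral_mul_fderiv_eq_neg_fderiv_mul_of_integrable (μ := (volume : Measure 𝔼))
    (f := fun _ => (1 : ℝ)) (g := w) (v := EuclideanSpace.single i 1) (by simp)
    (by simp only [one_mul]; exact hint) (by simpa using hw.continuous.integrable_of_hasCompactSupport hc)
    (fun x _ => differentiableAt_const _) (fun x _ => hw.differentiable (by simp) x)
  simp only [one_mul, fderiv_fun_const, Pi.zero_apply, zero_apply, zero_mul, integral_zero,
    neg_zero] at h
  exact h

theorem IsSmoothFun.lieDeriv_isSmoothFun {V : VField n M} (hV : IsSmoothField V) {h : M → ℝ}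
    (hh : IsSmoothFun n h) : IsSmoothFun n (lieDeriv V h) := by
  intro p
  have ho := (chartAt 𝔼 p).open_source
  have hp := mem_chart_source 𝔼 p
  have h1 : ContDiffOn ℝ ∞ (fun y => ∑ i, component p V i y
      * partialDeriv i (h ∘ (chartAt 𝔼 p).symm) y) (chartAt 𝔼 p).target :=
    ContDiffOn.sum fun i _ => (hV.component_contDiffOn p i).mul
      (((hh.contDiffOn p).fderiv_of_isOpen (chartAt 𝔼 p).open_target (by simp)).clm_apply
        contDiffOn_const)
  have h2 : ContMDiffOn (𝓡 n) 𝓘(ℝ, ℝ) ∞ ((fun y => ∑ i, component p V i y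
      * partialDeriv i (h ∘ (chartAt 𝔼 p).symm) y) ∘ chartAt 𝔼 p) (chartAt 𝔼 p).source :=
    h1.contMDiffOn.comp (contMDiffOn_chart (I := 𝓡 n)) (chartAt 𝔼 p).mapsTo
  refine (h2.congr fun q hq => ?_).contMDiffAt (ho.mem_nhds hp)
  have := lieDeriv_symm_eq_sum (V := V) ((chartAt 𝔼 p).map_source hq) (hh.mdifferentiableAt _)
  rwa [(chartAt 𝔼 p).left_inv hq] at this

section Volume

variable [MeasurableSpace M] [BorelSpace M] [CompactSpace M]

theorem integral_eq_integral_chart (g : SmoothMetric n M) (c : M) {u : M → ℝ} (hu : Continuous u)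
    (hsub : Function.support u ⊆ (chartAt 𝔼 c).source) :
    ∫ p, u p ∂(volumeMeasure g)
      = ∫ y in (chartAt 𝔼 c).target, volumeDensity g c y * u ((chartAt 𝔼 c).symm y) := by
  rw [← setIntegral_eq_integral_of_forall_compl_eq_zero (s := (chartAt 𝔼 c).source)
      fun x hx => Function.notMem_support.1 fun h => hx (hsub h),
    volumeMeasure_restrict_source, chartMeasure,
    integral_map (aemeasurable_chart_symm g c) hu.aestronglyMeasurable,
    integral_withDensity_eq_integral_toReal_smul₀
      (((volumeDensity_contDiffOn g c).continuousOn.aemeasurable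
        (chartAt 𝔼 c).open_target.measurableSet).ennreal_ofReal) (by simp)]
  refine setIntegral_congr_fun (chartAt 𝔼 c).open_target.measurableSet fun y hy => ?_
  simp [ENNReal.toReal_ofReal (volumeDensity_pos g hy).le]

/-- Since ∑ ∂ᵢ(ρYⁱ) = 0, the integrand ρ Y(ψ) in the chart is ∑ ∂ᵢ(ρYⁱψ), a sum of derivatives of
compactly supported functions. -/
theorem integral_lieDeriv_eq_zero_of_tsupport_subset [T2Space M] (g : SmoothMetric n M)
    {Y : VField n M} (hY : IsSmoothField Y) (hdiv : IsDivergenceFree g Y) {ψ : M → ℝ}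
    (hψ : IsSmoothFun n ψ) {c : M} (hsub : tsupport ψ ⊆ (chartAt 𝔼 c).source) :
    ∫ p, lieDeriv Y ψ p ∂(volumeMeasure g) = 0 := by
  set e := chartAt 𝔼 c
  have hsupp : Function.support (lieDeriv Y ψ) ⊆ tsupport ψ := by
    intro p hp
    by_contra h
    apply hp
    have h0 : ψ =ᶠ[nhds p] fun _ => 0 := notMem_tsupport_iff_eventuallyEq.1 h
    have : mfderiv (𝓡 n) 𝓘(ℝ, ℝ) ψ p = 0 := by
      rw [h0.mfderiv_eq, mfderiv_const]
      rfl
    rw [lieDeriv, differential, this]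
    rfl
  rw [integral_eq_integral_chart g c (hψ.lieDeriv_isSmoothFun hY).continuous (hsupp.trans hsub)]
  -- Extension by zero, as chart expressions mean nothing outside the target. It stays smooth
  -- because ψ has compact support inside the chart.
  set w : Fin n → 𝔼 → ℝ := fun i => e.target.indicator
    fun y => volumeDensity g c y * component c Y i y * (ψ ∘ e.symm) y with hw
  have hwo : ∀ i, ContDiffOn ℝ ∞ (fun y => volumeDensity g c y * component c Y i y
      * (ψ ∘ e.symm) y) e.target := fun i =>
    ((volumeDensity_contDiffOn g c).mul (hY.component_contDiffOn c i)).mul (hψ.contDiffOn c)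
  have hev : ∀ i, ∀ y ∈ e.target, w i =ᶠ[nhds y] fun y => volumeDensity g c y * component c Y i y
      * (ψ ∘ e.symm) y := fun i y hy => by
    filter_upwards [e.open_target.mem_nhds hy] with z hz
    simp [hw, hz]
  have hK : IsCompact (e '' tsupport ψ) :=
    (isClosed_tsupport ψ).isCompact.image_of_continuousOn (e.continuousOn.mono hsub)
  have hKt : e '' tsupport ψ ⊆ e.target := by
    rintro _ ⟨q, hq, rfl⟩
    exact e.map_source (hsub hq)
  have hw0 : ∀ i, ∀ y ∉ e '' tsupport ψ, w i y = 0 := by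
    intro i y hy
    by_cases hyt : y ∈ e.target
    · have : ψ (e.symm y) = 0 := by
        by_contra h
        exact hy ⟨e.symm y, subset_tsupport _ h, e.right_inv hyt⟩
      simp [hw, this]
    · simp [hw, hyt]
  have hwc : ∀ i, HasCompactSupport (w i) := fun i => HasCompactSupport.intro hK (hw0 i)
  have hws : ∀ i, ContDiff ℝ 1 (w i) := fun i => by
    refine contDiff_iff_contDiffAt.2 fun y => ?_
    by_cases hy : y ∈ e.target
    · exact (((hwo i).contDiffAt (e.open_target.mem_nhds hy)).of_le (by simp)).congr_of_eventuallyEq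
        (hev i y hy)
    · have hyK : y ∉ e '' tsupport ψ := fun h => hy (hKt h)
      refine contDiffAt_const (c := (0 : ℝ)) |>.congr_of_eventuallyEq ?_
      filter_upwards [hK.isClosed.isOpen_compl.mem_nhds hyK] with z hz using hw0 i z hz
  have hint : ∀ y ∈ e.target, volumeDensity g c y * lieDeriv Y ψ (e.symm y)
      = ∑ i, partialDeriv i (w i) y := by
    intro y hy
    have hρ := volumeDensity_pos g hy
    have hd := hdiv c y hy
    rw [chartDivergence, mul_eq_zero, or_iff_right (inv_ne_zero hρ.ne')] at hd
    have hρd := (volumeDensity_contDiffOn g c).differentiableAt_chart_target hy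
    have hYd := fun i => (hY.component_contDiffOn c i).differentiableAt_chart_target hy
    have hψd := (hψ.contDiffOn c).differentiableAt_chart_target hy
    have h1 : ∀ i, partialDeriv i (w i) y
        = volumeDensity g c y * (component c Y i y * partialDeriv i (ψ ∘ e.symm) y)
          + (ψ ∘ e.symm) y
            * partialDeriv i (fun z => volumeDensity g c z * component c Y i z) y := fun i => by
      rw [partialDeriv_congr (hev i y hy), partialDeriv_mul (hρd.fun_mul (hYd i)) hψd]
      ring
    simp only [h1, Finset.sum_add_distrib, ← Finset.mul_sum, hd, mul_zero, add_zero]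
    rw [lieDeriv_symm_eq_sum hy (hψ.mdifferentiableAt _)]
  rw [setIntegral_congr_fun e.open_target.measurableSet hint,
    setIntegral_eq_integral_of_forall_compl_eq_zero, integral_finsetSum]
  · exact Finset.sum_eq_zero fun i _ => (integral_partialDeriv_eq_zero (hws i) (hwc i) i).2
  · exact fun i _ => (integral_partialDeriv_eq_zero (hws i) (hwc i) i).1
  · intro y hy
    refine Finset.sum_eq_zero fun i _ => ?_
    have hyK : y ∉ e '' tsupport ψ := fun h => hy (hKt h)
    have : w i =ᶠ[nhds y] fun _ => 0 := by
      filter_upwards [hK.isClosed.isOpen_compl.mem_nhds hyK] with z hz using hw0 i z hz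
    rw [partialDeriv_congr this]
    simp [partialDeriv]

/-- The divergence theorem for a divergence-free field on a closed manifold. -/
theorem integral_lieDeriv_eq_zero [T2Space M] (g : SmoothMetric n M)
    {Y : VField n M} (hY : IsSmoothField Y) (hdiv : IsDivergenceFree g Y) {φ : M → ℝ}
    (hφ : IsSmoothFun n φ) : ∫ p, lieDeriv Y φ p ∂(volumeMeasure g) = 0 := by
  have := volumeMeasure_isFiniteMeasure g
  obtain ⟨ρ, hρ⟩ := SmoothPartitionOfUnity.exists_isSubordinate_chartAt_source (𝓡 n) M
  -- By compactness only finitely many members of the partition of unity are nonzero.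
  have hfin : {i | (Function.support (ρ i)).Nonempty}.Finite :=
    ρ.locallyFinite.finite_nonempty_of_compact
  set t := hfin.toFinset
  have hsum : ∀ p, ∑ i ∈ t, ρ i p = 1 := by
    intro p
    rw [← ρ.sum_eq_one (Set.mem_univ p)]
    refine (finsum_eq_sum_of_support_subset _ fun i hi => ?_).symm
    simp only [t, Set.Finite.coe_toFinset]
    exact ⟨p, hi⟩
  have hψ : ∀ i, IsSmoothFun n (fun p => ρ i p * φ p) := fun i => (ρ i).contMDiff.mul hφ
  have hsub : ∀ i, tsupport (fun p => ρ i p * φ p) ⊆ (chartAt 𝔼 i).source := fun i =>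
    (tsupport_mul_subset_left).trans (hρ i)
  have hdec : ∀ p, lieDeriv Y φ p = ∑ i ∈ t, lieDeriv Y (fun p => ρ i p * φ p) p := by
    intro p
    have hφs : φ = fun q => ∑ i ∈ t, ρ i q * φ q := by
      ext q
      rw [← Finset.sum_mul, hsum, one_mul]
    have hp := mem_chart_source 𝔼 p
    have hs : IsSmoothFun n (fun q => ∑ i ∈ t, ρ i q * φ q) := hφs ▸ hφ
    conv_lhs => rw [hφs]
    simp only [lieDeriv]
    rw [differential_eq_fderiv hp (hs.mdifferentiableAt p)]
    simp only [differential_eq_fderiv hp ((hψ _).mdifferentiableAt p)]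
    have : (fun q => ∑ i ∈ t, ρ i q * φ q) ∘ (chartAt 𝔼 p).symm
        = fun y => ∑ i ∈ t, ((fun q => ρ i q * φ q) ∘ (chartAt 𝔼 p).symm) y := rfl
    rw [this, fderiv_fun_sum fun i _ =>
      ((hψ i).contDiffOn p).differentiableAt_chart_target (mem_chart_target 𝔼 p), sum_apply]
  simp only [hdec]
  rw [integral_finsetSum]
  · exact Finset.sum_eq_zero fun i _ =>
      integral_lieDeriv_eq_zero_of_tsupport_subset g hY hdiv (hψ i) (hsub i)
  · exact fun i _ => ((hψ i).lieDeriv_isSmoothFun hY).continuous.integrable_of_hasCompactSupport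
      (HasCompactSupport.of_compactSpace _)

end Volume

/-! ### Leibniz rules, brackets and the regular set -/

theorem lieDeriv_mul (V : VField n M) {φ ψ : M → ℝ} (hφ : IsSmoothFun n φ) (hψ : IsSmoothFun n ψ)
    (p : M) : lieDeriv V (fun q => φ q * ψ q) p
      = φ p * lieDeriv V ψ p + ψ p * lieDeriv V φ p := by
  have hp := mem_chart_source 𝔼 p
  have hy := mem_chart_target 𝔼 p
  have hpr : IsSmoothFun n (fun q => φ q * ψ q) := ContMDiff.mul hφ hψ
  rw [lieDeriv, lieDeriv, lieDeriv, differential_eq_fderiv hp (hpr.mdifferentiableAt p),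
    differential_eq_fderiv hp (hφ.mdifferentiableAt p),
    differential_eq_fderiv hp (hψ.mdifferentiableAt p)]
  have : (fun q => φ q * ψ q) ∘ (chartAt 𝔼 p).symm
      = fun y => (φ ∘ (chartAt 𝔼 p).symm) y * (ψ ∘ (chartAt 𝔼 p).symm) y := rfl
  rw [this, fderiv_fun_mul ((hφ.contDiffOn p).differentiableAt_chart_target hy)
    ((hψ.contDiffOn p).differentiableAt_chart_target hy)]
  simp [(chartAt 𝔼 p).left_inv hp]

theorem lieDeriv_neg (V : VField n M) {φ : M → ℝ} (hφ : IsSmoothFun n φ) (p : M) :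
    lieDeriv V (fun q => -φ q) p = -lieDeriv V φ p := by
  have h := lieDeriv_mul V (contMDiff_const (c := (-1 : ℝ))) hφ p
  have h0 : lieDeriv V (fun _ : M => (-1 : ℝ)) p = 0 := by
    rw [lieDeriv, differential, mfderiv_const]
    rfl
  simpa [h0] using h

/-- [fX,Y] = f[X,Y] - Y(f)X. It is applied twice, the second time with -Y(f) in place of f. -/
theorem mlieBracket_smul_of_commute {X Y : VField n M} (hX : IsSmoothField X) {f : M → ℝ}
    (hf : IsSmoothFun n f) (hXY : ∀ p, VectorField.mlieBracket (𝓡 n) X Y p = 0) (p : M) :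
    VectorField.mlieBracket (𝓡 n) (fun q => f q • X q) Y p = (-lieDeriv Y f p) • X p := by
  have h := VectorField.mlieBracket_smul_left (W := Y) (hf.mdifferentiableAt p)
    ((hX p).mdifferentiableAt (by simp))
  rw [hXY p, smul_zero, add_zero] at h
  exact h

theorem isOpen_regularSet {g : SmoothMetric n M} {X : VField n M} (hX : IsSmoothField X) :
    IsOpen (regularSet g X) := by
  have hη := hX.normSq_isSmoothFun g
  refine isOpen_iff_mem_nhds.2 fun p hp => ?_
  have hps := mem_chart_source 𝔼 p
  set e := chartAt 𝔼 p
  obtain ⟨v, hv⟩ := exists_differential_ne_zero g hp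
  rw [differential_eq_fderiv hps (hη.mdifferentiableAt p)] at hv
  have hc : ContinuousOn (fderiv ℝ (normSq g X ∘ e.symm)) e.target :=
    (hη.contDiffOn p).continuousOn_fderiv_of_isOpen e.open_target (by simp)
  -- The vector is frozen in coordinates; a differential nonzero on it at p stays nonzero nearby.
  have hcp : ContinuousAt (fun q => fderiv ℝ (normSq g X ∘ e.symm) (e q) (chartDeriv p p v)) p :=
    ((hc.continuousAt (e.open_target.mem_nhds (mem_chart_target 𝔼 p))).comp
      (e.continuousAt hps)).clm_apply continuousAt_const
  filter_upwards [hcp.eventually_ne hv, e.open_source.mem_nhds hps] with q hq hqs h0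
  obtain ⟨w, hw⟩ := (chartDeriv_isInvertible hqs).surjective (chartDeriv p p v)
  apply hq
  rw [← hw, ← differential_eq_fderiv hqs (hη.mdifferentiableAt q), ← inner_gradient g, h0]
  simp

/-- The right side is smooth on all of M, so no regularity of F is ever needed. -/
theorem IsGradRatio.mul_sq_eq {g : SmoothMetric n M} {f : M → ℝ} {X : VField n M} {F : M → ℝ}
    (hF : IsGradRatio g f X F) (Y : VField n M) {p : M} (hp : p ∈ regularSet g X) :
    F p * lieDeriv Y (normSq g X) p ^ 2
      = lieDeriv Y (fun q => f q ^ 2) p * lieDeriv Y (normSq g X) p := by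
  have h := congrArg (fun w => g.inner p w (Y p)) (hF p hp)
  simp only [map_smul, smul_apply, smul_eq_mul, inner_gradient] at h
  rw [lieDeriv, lieDeriv, h]
  ring

theorem lieDeriv_normSq_eq_zero {g : SmoothMetric n M} {X : VField n M} (Y : VField n M) {p : M}
    (hp : p ∉ regularSet g X) : lieDeriv Y (normSq g X) p = 0 := by
  have h0 : gradient g (normSq g X) p = 0 := not_not.1 hp
  rw [lieDeriv, ← inner_gradient g, h0]
  simp

/-! ### The Misiołek curvature -/

section Volume

variable [MeasurableSpace M] [BorelSpace M] [CompactSpace M]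

theorem IsSmoothFun.integrable (g : SmoothMetric n M) {φ : M → ℝ} (hφ : IsSmoothFun n φ) :
    Integrable φ (volumeMeasure g) :=
  have := volumeMeasure_isFiniteMeasure g
  hφ.continuous.integrable_of_hasCompactSupport (HasCompactSupport.of_compactSpace _)

/-- Integration by parts for the Misiołek curvature of `fX` along a divergence-free field
commuting with `X`. -/
theorem misiolekCurvature_smul_eq [T2Space M] (g : SmoothMetric n M) {X Y : VField n M} {f : M → ℝ}
    (hX : IsSmoothField X) (hf : IsSmoothFun n f) (hY : IsSmoothField Y)
    (hdiv : IsDivergenceFree g Y) (hXY : ∀ p, VectorField.mlieBracket (𝓡 n) X Y p = 0) :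
    misiolekCurvature g (fun p => f p • X p) Y
      = (1 / 2) * ∫ p, lieDeriv Y (fun q => f q ^ 2) p * lieDeriv Y (normSq g X) p
          ∂(volumeMeasure g) := by
  have hη := hX.normSq_isSmoothFun g
  have hYf := hf.lieDeriv_isSmoothFun hY
  have hYYf := hYf.lieDeriv_isSmoothFun hY
  have hYη := hη.lieDeriv_isSmoothFun hY
  have hnYf : IsSmoothFun n (fun p => -lieDeriv Y f p) := ContMDiff.neg hYf
  have hb1 : VectorField.mlieBracket (𝓡 n) (fun q => f q • X q) Y
      = fun p => (-lieDeriv Y f p) • X p := funext (mlieBracket_smul_of_commute hX hf hXY)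
  have hb2 : VectorField.mlieBracket (𝓡 n) (fun p => (-lieDeriv Y f p) • X p) Y
      = fun p => lieDeriv Y (lieDeriv Y f) p • X p := funext fun p => by
    rw [mlieBracket_smul_of_commute hX hnYf hXY, lieDeriv_neg Y hYf, neg_neg]
  have s1 : IsSmoothFun n (fun p => lieDeriv Y f p ^ 2 * normSq g X p) :=
    ContMDiff.mul (hYf.pow 2) hη
  have s2 : IsSmoothFun n (fun p => f p * lieDeriv Y (lieDeriv Y f) p * normSq g X p) :=
    ContMDiff.mul (ContMDiff.mul hf hYYf) hη
  have s3 : IsSmoothFun n (fun p => f p * lieDeriv Y f p * lieDeriv Y (normSq g X) p) :=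
    ContMDiff.mul (ContMDiff.mul hf hYf) hYη
  have hffY : IsSmoothFun n (fun p => f p * lieDeriv Y f p) := ContMDiff.mul hf hYf
  -- The Y-derivative of f Y(f) η consists of the two integrands of the curvature and f Y(f) Y(η),
  -- which is half of the target integrand.
  have h0 := integral_lieDeriv_eq_zero g hY hdiv (φ := fun p => f p * lieDeriv Y f p * normSq g X p)
    (ContMDiff.mul hffY hη)
  have h1 : ∀ p, lieDeriv Y (fun p => f p * lieDeriv Y f p * normSq g X p) p
      = lieDeriv Y f p ^ 2 * normSq g X p + f p * lieDeriv Y (lieDeriv Y f) p * normSq g X p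
        + f p * lieDeriv Y f p * lieDeriv Y (normSq g X) p := fun p => by
    rw [lieDeriv_mul Y hffY hη, lieDeriv_mul Y hf hYf]
    ring
  simp only [h1] at h0
  rw [integral_add ((s1.integrable g).fun_add (s2.integrable g)) (s3.integrable g),
    integral_add (s1.integrable g) (s2.integrable g)] at h0
  have h2 : ∀ p, lieDeriv Y (fun q => f q ^ 2) p * lieDeriv Y (normSq g X) p
      = 2 * (f p * lieDeriv Y f p * lieDeriv Y (normSq g X) p) := fun p => by
    simp only [pow_two]
    rw [lieDeriv_mul Y hf hf]
    ring
  simp only [misiolekCurvature, hb1, hb2, h2, integral_const_mul]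
  have h3 : ∀ p, g.inner p ((-lieDeriv Y f p) • X p) ((-lieDeriv Y f p) • X p)
      = lieDeriv Y f p ^ 2 * normSq g X p := fun p => by
    simp only [map_smul, smul_apply, smul_eq_mul, normSq]
    ring
  have h4 : ∀ p, g.inner p (f p • X p) (lieDeriv Y (lieDeriv Y f) p • X p)
      = f p * lieDeriv Y (lieDeriv Y f) p * normSq g X p := fun p => by
    simp only [map_smul, smul_apply, smul_eq_mul, normSq]
    ring
  simp only [h3, h4]
  linarith

end Volume

end ZonalFlow

end

/-! ### The main theorem -/

theorem mainTheorem5 {n : ℕ} {M : Type*} [TopologicalSpace M]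
    [ChartedSpace (EuclideanSpace ℝ (Fin n)) M] [IsManifold (𝓡 n) ∞ M]
    [CompactSpace M] [T2Space M] [MeasurableSpace M] [BorelSpace M]
    (g : ZonalFlow.SmoothMetric n M) (Z X : ZonalFlow.VField n M) (f : M → ℝ)
    (hZ : ZonalFlow.IsZonalFlow g Z) (hf : ZonalFlow.IsSmoothFun n f)
    (hX : ZonalFlow.IsKilling g X) (hZfX : ∀ p, Z p = f p • X p) :
    (∃ F : M → ℝ, ZonalFlow.IsGradRatio g f X F) ∧
    ∀ F : M → ℝ, ZonalFlow.IsGradRatio g f X F →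
      ∀ Y : ZonalFlow.VField n M, ZonalFlow.IsSmoothField Y → ZonalFlow.IsDivergenceFree g Y →
        (∀ p, VectorField.mlieBracket (𝓡 n) X Y p = 0) →
        (IntegrableOn (fun p => F p * ZonalFlow.lieDeriv Y (ZonalFlow.normSq g X) p ^ 2)
            (ZonalFlow.regularSet g X) (ZonalFlow.volumeMeasure g) ∧
          ZonalFlow.misiolekCurvature g Z Y =
            (1 / 2) * ∫ p in ZonalFlow.regularSet g X,
              F p * ZonalFlow.lieDeriv Y (ZonalFlow.normSq g X) p ^ 2
                ∂(ZonalFlow.volumeMeasure g)) ∧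
        (ZonalFlow.fieldSupport Y ⊆ {p | p ∈ ZonalFlow.regularSet g X ∧ 0 < F p} →
          (∃ p ∈ ZonalFlow.regularSet g X, 0 < F p ∧
            ZonalFlow.lieDeriv Y (ZonalFlow.normSq g X) p ≠ 0) →
          0 < ZonalFlow.misiolekCurvature g Z Y) := by
  obtain rfl : Z = fun p => f p • X p := funext hZfX
  refine ⟨hZ.exists_isGradRatio hX hf, fun F hF Y hY hdiv hXY => ?_⟩
  have hopen := ZonalFlow.isOpen_regularSet (g := g) hX.1
  have hη := hX.1.normSq_isSmoothFun g
  have hsmooth : ZonalFlow.IsSmoothFun n (fun p =>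
      ZonalFlow.lieDeriv Y (fun q => f q ^ 2) p * ZonalFlow.lieDeriv Y (ZonalFlow.normSq g X) p) :=
    ContMDiff.mul (ZonalFlow.IsSmoothFun.lieDeriv_isSmoothFun hY (hf.pow 2))
      (hη.lieDeriv_isSmoothFun hY)
  have hmc := ZonalFlow.misiolekCurvature_smul_eq g hX.1 hf hY hdiv hXY
  refine ⟨⟨?_, ?_⟩, fun hsupp ⟨p, hp, hFp, hYp⟩ => ?_⟩
  · exact (hsmooth.integrable g).integrableOn.congr_fun
      (fun p hp => (hF.mul_sq_eq Y hp).symm) hopen.measurableSet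
  · rw [hmc, setIntegral_congr_fun hopen.measurableSet fun p hp => hF.mul_sq_eq Y hp,
      setIntegral_eq_integral_of_forall_compl_eq_zero fun p hp => ?_]
    rw [ZonalFlow.lieDeriv_normSq_eq_zero Y hp, mul_zero]
  · have := ZonalFlow.volumeMeasure_isFiniteMeasure g
    have := ZonalFlow.volumeMeasure_isOpenPosMeasure g
    rw [hmc]
    -- Nonnegativity is checked on all of M: on U⁺ the integrand is F Y(η)², on the rest of U₀ the
    -- support condition forces Y = 0, and off U₀ dη = 0.
    refine mul_pos (by norm_num) (hsmooth.continuous.integral_pos_of_hasCompactSupport_nonneg_nonzero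
      (.of_compactSpace _) (fun q => ?_) (x := p) ?_)
    · by_cases hq : q ∈ ZonalFlow.regularSet g X
      · by_cases hFq : 0 < F q
        · simp only [← hF.mul_sq_eq Y hq]
          exact mul_nonneg hFq.le (sq_nonneg _)
        · have hYq : Y q = 0 := by
            by_contra h
            exact hFq (hsupp (subset_closure h)).2
          simp [ZonalFlow.lieDeriv, hYq]
      · simp [ZonalFlow.lieDeriv_normSq_eq_zero Y hq]
    · simp only [← hF.mul_sq_eq Y hp]
      exact mul_ne_zero hFp.ne' (pow_ne_zero 2 hYp)
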